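/- Let $n$ and $m$ be positive integers. A coloured quiver has a finite vertex set and finitely many arrows with colours in $\{0,1,\dots,m\}$. Its mutation at a vertex $j$ is obtained as follows. (1) For each pair of arrows $i\to j$ of colour $c$ and $j\to k$ of colour $0$ with $i\neq k$, add an arrow $i\to k$ of colour $c$ and an arrow $k\to i$ of colour $m-c$. (2) If there are arrows of different colours from a vertex $i$ to a vertex $k$, cancel the same number of arrows of each colour until there are only arrows of one colour from $i$ to $k$. (3) Add one to the colour of every arrow going into $j$ and subtract one from the colour of every arrow going out of $j$ (colours taken modulo $m+1$). Choose any orientation of the Dynkin diagram $A_{n-1}$ (a path with $n-1$ vertices; empty if $n=1$), and regard it as a coloured quiver with one arrow $i\to j$ of colour $0$ and one arrow $j\to i$ of colour $m$ for each arrow $i\to j$ of the orientation. The $m$-mutation class of type $A_{n-1}$ consists of all coloured quivers obtained from it by finitely many mutations, considered up to isomorphism of coloured quivers. Let $P_{n,m}$ be a regular $(nm+2)$-gon. An $m$-diagonal is a diagonal joining two non-adjacent vertices that divides $P_{n,m}$ into two polygons whose numbers of sides are both congruent to $2$ modulo $m$. An $(m+2)$-angulation of $P_{n,m}$ is a maximal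 set of $m$-diagonals no two of which cross in the interior. Two $(m+2)$-angulations are equivalent if one is obtained from the other by a rotation of $P_{n,m}$. Then, for every choice of the orientation, the $m$-mutation class of type $A_{n-1}$ is finite, and its number of elements (isomorphism classes of coloured quivers) equals the number of equivalence classes of $(m+2)$-angulations of $P_{n,m}$ under rotation. -/

import Mathlib

/-- A coloured quiver with vertex set `V` and colours `0, 1, …, m`:
`Q i j c` is the number of arrows of colour `c` from `i` to `j`. -/
abbrev ColouredQuiver (V : Type*) (m : ℕ) : Type _ := V → V → Fin (m + 1) → ℕ

namespace ColouredQuiver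

variable {V : Type*} {m : ℕ}

/-- First step of the mutation at `j`: for each pair of arrows `i ⟶ j` of colour `c` and `j ⟶ k`
of colour `0`, with `i ≠ k`, add an arrow `i ⟶ k` of colour `c` and an arrow `k ⟶ i` of colour
`m - c` (which is `c.rev`). The arrows added from `i` to `k` come from the paths `i ⟶ j ⟶ k`
(first product) and from the paths `k ⟶ j ⟶ i` (second product). -/
def addPaths [DecidableEq V] (Q : ColouredQuiver V m) (j : V) : ColouredQuiver V m :=
  fun i k c => Q i k c + if i = k then 0 else Q i j c * Q j k 0 + Q k j c.rev * Q j i 0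

/-- Second step: if there are arrows of different colours from `i` to `k`, cancel the same number
of arrows of each colour until only arrows of one colour are left (truncated subtraction). -/
def cancel (Q : ColouredQuiver V m) : ColouredQuiver V m :=
  fun i k c => Q i k c - ∑ t ∈ Finset.univ.erase c, Q i k t

/-- Third step: add one to the colour of all arrows going into `j` and subtract one from the colour
of all arrows going out of `j`, colours being taken modulo `m + 1`. -/
def shiftColours [DecidableEq V] (Q : ColouredQuiver V m) (j : V) : ColouredQuiver V m :=
  fun i k c =>
    if i = k then Q i k c
    else if k = j then Q i k (c - 1)
    else if i = j then Q i k (c + 1)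
    else Q i k c

/-- Coloured quiver mutation at the vertex `j`. -/
def mutate [DecidableEq V] (Q : ColouredQuiver V m) (j : V) : ColouredQuiver V m :=
  shiftColours (cancel (addPaths Q j)) j

/-- The coloured quivers obtained from `Q` by finitely many mutations. -/
def mutationClass [DecidableEq V] (Q : ColouredQuiver V m) : Set (ColouredQuiver V m) :=
  {Q' | Relation.ReflTransGen (fun R R' : ColouredQuiver V m => ∃ j, R' = mutate R j) Q Q'}

/-- Isomorphism of coloured quivers on the same vertex set, restricted to a set of quivers. -/
def isoSetoid (S : Set (ColouredQuiver V m)) : Setoid S where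
  r Q Q' := ∃ σ : Equiv.Perm V, ∀ i j c, Q'.1 (σ i) (σ j) c = Q.1 i j c
  iseqv :=
    { refl := fun _ => ⟨Equiv.refl V, fun _ _ _ => rfl⟩
      symm := by
        rintro Q Q' ⟨σ, h⟩
        exact ⟨σ.symm, fun i j c => by simpa using (h (σ.symm i) (σ.symm j) c).symm⟩
      trans := by
        rintro Q Q' Q'' ⟨σ, h⟩ ⟨τ, h'⟩
        exact ⟨σ.trans τ, fun i j c => (h' (σ i) (σ j) c).trans (h i j c)⟩ }

/-- The arrows of the orientation of the Dynkin diagram `A_k` (the path `0 - 1 - ⋯ - (k-1)`)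
given by `o`: the edge between `i` and `i + 1` is directed `i ⟶ i + 1` if `o i = true`, and
`i + 1 ⟶ i` if `o i = false`. -/
def DynkinArrow {k : ℕ} (o : ℕ → Bool) (i j : Fin k) : Prop :=
  (i.val + 1 = j.val ∧ o i.val = true) ∨ (j.val + 1 = i.val ∧ o j.val = false)

open Classical in
/-- The coloured quiver of an orientation of `A_k`: one arrow `i ⟶ j` of colour `0` and one arrow
`j ⟶ i` of colour `m` for every arrow `i ⟶ j` of the orientation, and no other arrows. -/
noncomputable def dynkinA (k m : ℕ) (o : ℕ → Bool) : ColouredQuiver (Fin k) m :=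
  fun i j c =>
    (if DynkinArrow o i j ∧ c = 0 then 1 else 0) +
      (if DynkinArrow o j i ∧ c = Fin.last m then 1 else 0)

end ColouredQuiver

/-! The vertices of an `N`-gon are labelled clockwise by `ZMod N`, and `(j - i).val` is the number
of border edges passed on the way clockwise from the vertex `i` to the vertex `j`. -/

namespace Polygon

/-- The `m`-diagonals of the `N`-gon: they join two vertices that are neither equal nor neighbours,
and cut the polygon into two polygons whose numbers of sides (border edges, plus one for the
diagonal) are both congruent to `2` modulo `m`. -/
def IsMDiagonal (m : ℕ) {N : ℕ} (d : Sym2 (ZMod N)) : Prop :=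
  ∃ i j : ZMod N, d = s(i, j) ∧ 2 ≤ (j - i).val ∧ 2 ≤ (i - j).val ∧
    (j - i).val + 1 ≡ 2 [MOD m] ∧ (i - j).val + 1 ≡ 2 [MOD m]

/-- The vertex `c` lies strictly between `a` and `b` on the way clockwise from `a` to `b`. -/
def StrictlyBetween {N : ℕ} (a c b : ZMod N) : Prop :=
  0 < (c - a).val ∧ (c - a).val < (b - a).val

/-- Two diagonals cross in the interior of the polygon: the end points of the second lie strictly
on different sides of the first. -/
def Cross {N : ℕ} (d e : Sym2 (ZMod N)) : Prop :=
  ∃ a b x y : ZMod N, d = s(a, b) ∧ e = s(x, y) ∧ StrictlyBetween a x b ∧ StrictlyBetween b y a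

/-- The `(m+2)`-angulations of the `N`-gon: the maximal sets of pairwise non-crossing
`m`-diagonals. -/
def IsAngulation (m : ℕ) {N : ℕ} (Δ : Finset (Sym2 (ZMod N))) : Prop :=
  Maximal (fun S : Finset (Sym2 (ZMod N)) =>
    (∀ d ∈ S, IsMDiagonal m d) ∧ ∀ d ∈ S, ∀ e ∈ S, ¬ Cross d e) Δ

/-- The `(m+2)`-angulations of the `N`-gon. -/
abbrev Angulation (m N : ℕ) : Type := {Δ : Finset (Sym2 (ZMod N)) // IsAngulation m Δ}

/-- Rotation of a set of diagonals by `t` steps. -/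
def rotate {N : ℕ} (t : ZMod N) (Δ : Finset (Sym2 (ZMod N))) : Finset (Sym2 (ZMod N)) :=
  Δ.image (Sym2.map (fun i => i + t))

theorem rotate_zero {N : ℕ} (Δ : Finset (Sym2 (ZMod N))) : rotate 0 Δ = Δ := by
  simp [rotate]

theorem rotate_rotate {N : ℕ} (s t : ZMod N) (Δ : Finset (Sym2 (ZMod N))) :
    rotate t (rotate s Δ) = rotate (s + t) Δ := by
  simp [rotate, Finset.image_image, Function.comp_def, Sym2.map_map, add_assoc]

/-- Two `(m+2)`-angulations are equivalent if one is a rotation of the other. -/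
def rotationSetoid (m N : ℕ) : Setoid (Angulation m N) where
  r Δ Δ' := ∃ t : ZMod N, Δ'.1 = rotate t Δ.1
  iseqv :=
    { refl := fun Δ => ⟨0, (rotate_zero Δ.1).symm⟩
      symm := by
        rintro Δ Δ' ⟨t, h⟩
        exact ⟨-t, by rw [h, rotate_rotate, add_neg_cancel, rotate_zero]⟩
      trans := by
        rintro Δ Δ' Δ'' ⟨s, h⟩ ⟨t, h'⟩
        exact ⟨s + t, by rw [h', h, rotate_rotate]⟩ }

end Polygon

/-! A labelled dissection of the polygon into `(m+2)`-gons carries a coloured quiver: diagonals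
bounding a common cell are joined by arrows whose colour counts the sides of that cell strictly
between them, clockwise. Rotating the diagonal `j` one step clockwise inside the union of its two
cells is the same as mutating this quiver at `j` (`quiver_flip`), and every orientation of the
Dynkin diagram is the quiver of a chain of cells (`exists_quiver_eq_dynkinA`). So the mutation class
consists of quivers of dissections.

Conversely, one-step rotations lead from any dissection to any `(m+2)`-angulation
(`exists_reach_isAngulation`): a diagonal crossing a wanted one is turned until it meets an end
point of the latter, which lowers the number of crossings.

Finally, quivers are isomorphic exactly when the sets of diagonals differ by a rotation
(`iso_iff_rotate`). The diagonals determine the cells. In the other direction the quiver tells how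
the neighbours of a diagonal split between its two cells; the lengths of all sides follow
recursively from the border edges, and so do all positions once one diagonal is placed. Pairing
quivers with angulations through common dissections is then a bijection of the two quotients, and a
polygon has only finitely many sets of diagonals.

Dissections are treated as tables of first vertices and lengths. Planarity is recovered by counting:
lengths around a cell add up to `N`, and so do the lengths of the two sides of a diagonal. -/

/-- A dissection of the `N`-gon into cells with `m + 2` sides, the cells being indexed by `C` and the
diagonals by `V`. The sides of the cell `c` are the pairs `(c, p)`; going clockwise around the cell,
the side `x` starts at the vertex `st x` and spans `len x` border edges. The diagonal `v` is a side of
two cells, namely `pos (v, false)` and `pos (v, true)`. -/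
structure CellDissection (V C : Type*) [Fintype V] [Fintype C] (m N : ℕ) where
  st : C × ZMod (m + 2) → ZMod N
  len : C × ZMod (m + 2) → ℕ
  pos : V × Bool → C × ZMod (m + 2)
  m_pos : 0 < m
  pos_inj : Function.Injective pos
  len_pos : ∀ x, 0 < len x
  len_mod : ∀ x, len x ≡ 1 [MOD m]
  sum_len : ∀ c, ∑ p, len (c, p) = N
  st_next : ∀ c p, st (c, p + 1) = st (c, p) + len (c, p)
  st_op : ∀ v s, st (pos (v, !s)) = st (pos (v, s)) + len (pos (v, s))
  len_op : ∀ v s, len (pos (v, s)) + len (pos (v, !s)) = N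
  len_border : ∀ x, x ∉ Set.range pos → len x = 1
  -- Leaves exactly `N` sides for the border. This is what makes the border sides distinct edges and
  -- the dual graph connected.
  card_eq : Fintype.card C * (m + 2) = 2 * Fintype.card V + N

/-! ### Arcs cut off by sides, and the dual tree of a dissection. -/

namespace CellDissection

section Shift

variable {C : Type*} {m : ℕ}

/-- The side of the same cell which comes `k` steps after `x`. -/
def shift (k : ZMod (m + 2)) (x : C × ZMod (m + 2)) : C × ZMod (m + 2) :=
  (x.1, x.2 + k)

@[simp] theorem shift_fst (k : ZMod (m + 2)) (x : C × ZMod (m + 2)) : (shift k x).1 = x.1 := rfl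

@[simp] theorem shift_snd (k : ZMod (m + 2)) (x : C × ZMod (m + 2)) :
    (shift k x).2 = x.2 + k := rfl

theorem shift_shift (k l : ZMod (m + 2)) (x : C × ZMod (m + 2)) :
    shift k (shift l x) = shift (l + k) x := by
  simp [shift, add_assoc]

theorem shift_zero (x : C × ZMod (m + 2)) : shift 0 x = x := by simp [shift]

theorem shift_inj {k : ZMod (m + 2)} {x y : C × ZMod (m + 2)} (h : shift k x = shift k y) :
    x = y := by
  have := congrArg (shift (-k)) h
  simpa [shift_shift, shift_zero] using this

theorem shift_eq_shift {k l : ZMod (m + 2)} {x : C × ZMod (m + 2)} :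
    shift k x = shift l x ↔ k = l := by
  simp [shift]

theorem shift_eq_self {k : ZMod (m + 2)} {x : C × ZMod (m + 2)} : shift k x = x ↔ k = 0 := by
  simp [shift, Prod.ext_iff]

theorem fst_eq_of_eq_shift {k : ZMod (m + 2)} {x y : C × ZMod (m + 2)} (h : y = shift k x) :
    y.1 = x.1 := by
  rw [h, shift_fst]

theorem exists_shift {x y : C × ZMod (m + 2)} (h : x.1 = y.1) : ∃ k, y = shift k x :=
  ⟨y.2 - x.2, by ext <;> simp [h]⟩

theorem one_ne_zero_zmod : (1 : ZMod (m + 2)) ≠ 0 := by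
  have : Fact (1 < m + 2) := ⟨by omega⟩
  exact one_ne_zero

theorem exists_ne_fst_eq (x : C × ZMod (m + 2)) : ∃ y : C × ZMod (m + 2), x.1 = y.1 ∧ x ≠ y :=
  ⟨shift 1 x, rfl, fun h => one_ne_zero_zmod (shift_eq_self.1 h.symm)⟩

theorem val_natCast_of_lt {k N : ℕ} (h : k < N) : (k : ZMod N).val = k := by
  rw [ZMod.val_natCast, Nat.mod_eq_of_lt h]

end Shift

variable {V C : Type*} [Fintype V] [Fintype C] {m N : ℕ} (X : CellDissection V C m N)

theorem st_shift_one (x : C × ZMod (m + 2)) : X.st (shift 1 x) = X.st x + X.len x :=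
  X.st_next x.1 x.2

/-- As `m > 0`, a cell has a third side, of positive length. The separation statements below all
come from this inequality and `len_op`. -/
theorem len_add_len_lt {x y : C × ZMod (m + 2)} (h : x.1 = y.1) (hne : x ≠ y) :
    X.len x + X.len y < N := by
  classical
  obtain ⟨c, p⟩ := x
  obtain ⟨c', q⟩ := y
  obtain rfl : c = c' := h
  have hpq : p ≠ q := fun h => hne (by rw [h])
  have hcard : 2 < Fintype.card (ZMod (m + 2)) := by
    rw [ZMod.card]; have := X.m_pos; omega
  obtain ⟨r, hr⟩ : ∃ r, r ∉ ({p, q} : Finset (ZMod (m + 2))) := by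
    by_contra! hall
    have h1 : Fintype.card (ZMod (m + 2)) ≤ ({p, q} : Finset (ZMod (m + 2))).card :=
      Finset.card_le_card (fun r _ => hall r)
    have := Finset.card_le_two (a := p) (b := q)
    omega
  have hle : ∑ t ∈ ({r, p, q} : Finset (ZMod (m + 2))), X.len (c, t) ≤ ∑ t, X.len (c, t) :=
    Finset.sum_le_sum_of_subset (Finset.subset_univ _)
  rw [Finset.sum_insert hr, Finset.sum_pair hpq, X.sum_len] at hle
  have := X.len_pos (c, r)
  omega

theorem len_lt (x : C × ZMod (m + 2)) : X.len x < N := by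
  obtain ⟨y, h, hne⟩ := exists_ne_fst_eq x
  have := X.len_add_len_lt h hne
  omega

theorem two_le_len (d : V × Bool) : 2 ≤ X.len (X.pos d) := by
  obtain ⟨v, s⟩ := d
  obtain ⟨y, h, hne⟩ := exists_ne_fst_eq (X.pos (v, !s))
  have := X.len_add_len_lt h hne
  have := X.len_op v s
  have := X.len_pos y
  omega

theorem cell_ne (v : V) (s : Bool) : (X.pos (v, s)).1 ≠ (X.pos (v, !s)).1 := by
  intro h
  have := X.len_add_len_lt h (fun e => by simpa using X.pos_inj e)
  have := X.len_op v s
  omega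

theorem pos_ne {v w : V} (h : v ≠ w) (s t : Bool) : X.pos (v, s) ≠ X.pos (w, t) :=
  fun e => h (congrArg Prod.fst (X.pos_inj e))

/-- If both pairs of opposite sides shared a cell, the four lengths would add up to `2 * N` by
`len_op`, but to less by `len_add_len_lt`. -/
theorem not_share_two {v w : V} (h : v ≠ w) {s s' t t' : Bool}
    (h1 : (X.pos (v, s)).1 = (X.pos (w, t)).1) (h2 : (X.pos (v, s')).1 = (X.pos (w, t')).1) :
    s = s' ∧ t = t' := by
  have key : ∀ s t, (X.pos (v, s)).1 = (X.pos (w, t)).1 →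
      (X.pos (v, !s)).1 ≠ (X.pos (w, !t)).1 := by
    intro s t h1 h2
    have a1 := X.len_add_len_lt h1 (X.pos_ne h _ _)
    have a2 := X.len_add_len_lt h2 (X.pos_ne h _ _)
    have a3 := X.len_op v s
    have a4 := X.len_op w t
    omega
  by_cases hs : s' = s
  · subst hs
    refine ⟨rfl, ?_⟩
    by_contra ht
    have : t' = !t := by cases t <;> cases t' <;> simp_all
    subst this
    exact X.cell_ne w t (h1.symm.trans h2)
  · have hs' : s' = !s := by cases s <;> cases s' <;> simp_all
    subst hs'
    by_cases ht : t' = t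
    · subst ht
      exact absurd (h1.trans h2.symm) (X.cell_ne v s)
    · have : t' = !t := by cases t <;> cases t' <;> simp_all
      subst this
      exact absurd h2 (key s t h1)

/-- The dual graph has no triangle: three cells pairwise separated by three diagonals would have six
sides of total length `3 * N`, while each cell allows less than `N`. -/
theorem not_triangle {i j k : V} (hij : i ≠ j) (hjk : j ≠ k) (hik : i ≠ k) {s a b : Bool}
    (h1 : (X.pos (i, a)).1 = (X.pos (j, s)).1) (h2 : (X.pos (j, !s)).1 = (X.pos (k, b)).1)
    (a' b' : Bool) : (X.pos (i, a')).1 ≠ (X.pos (k, b')).1 := by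
  intro h3
  by_cases ha : a' = a
  · subst ha
    have := (X.not_share_two hjk (h1.symm.trans h3) h2).1
    cases s <;> simp at this
  by_cases hb : b' = b
  · subst hb
    have := (X.not_share_two hij h1 (h3.trans h2.symm)).2
    cases s <;> simp at this
  have ha : a' = !a := by cases a <;> cases a' <;> simp_all
  have hb : b' = !b := by cases b <;> cases b' <;> simp_all
  subst ha hb
  have a1 := X.len_add_len_lt h1 (X.pos_ne hij _ _)
  have a2 := X.len_add_len_lt h2 (X.pos_ne hjk _ _)
  have a3 := X.len_add_len_lt h3 (X.pos_ne hik _ _)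
  have a4 := X.len_op i a
  have a5 := X.len_op j s
  have a6 := X.len_op k b
  omega

/-- Lengths drop on crossing a diagonal; this makes the walks through the cells terminate. -/
theorem len_lt_of_fst_eq_op {v : V} {s : Bool} {y : C × ZMod (m + 2)}
    (h : y.1 = (X.pos (v, !s)).1) (hne : y ≠ X.pos (v, !s)) :
    X.len y < X.len (X.pos (v, s)) := by
  have := X.len_add_len_lt h hne
  have := X.len_op v s
  omega

/-- The border edges cut off by the side `x`; a border edge is given by its first vertex. -/
def arc (x : C × ZMod (m + 2)) : Set (ZMod N) := {a | (a - X.st x).val < X.len x}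

theorem mem_arc {x : C × ZMod (m + 2)} {a : ZMod N} :
    a ∈ X.arc x ↔ (a - X.st x).val < X.len x := Iff.rfl

theorem st_mem_arc (x : C × ZMod (m + 2)) : X.st x ∈ X.arc x := by
  simp [mem_arc, X.len_pos]

theorem st_add_len_notMem_arc (x : C × ZMod (m + 2)) : X.st x + X.len x ∉ X.arc x := by
  rw [mem_arc, add_sub_cancel_left, val_natCast_of_lt (X.len_lt x)]
  omega

theorem st_add_len_sub_one_mem_arc (x : C × ZMod (m + 2)) : X.st x + X.len x - 1 ∈ X.arc x := by
  have h := X.len_pos x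
  have e : X.st x + X.len x - 1 - X.st x = ((X.len x - 1 : ℕ) : ZMod N) := by
    rw [Nat.cast_sub (by omega)]; push_cast; ring
  have := X.len_lt x
  rw [mem_arc, e, val_natCast_of_lt (by omega)]
  omega

variable [NeZero N]

theorem arc_op (v : V) (s : Bool) : X.arc (X.pos (v, !s)) = (X.arc (X.pos (v, s)))ᶜ := by
  ext a
  rw [Set.mem_compl_iff, mem_arc, mem_arc, X.st_op]
  have h1 := X.len_op v s
  have h2 := X.len_lt (X.pos (v, s))
  set l := X.len (X.pos (v, s))
  have hr : ((a - X.st (X.pos (v, s))).val) < N := ZMod.val_lt _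
  have he : a - (X.st (X.pos (v, s)) + (l : ZMod N)) =
      (((a - X.st (X.pos (v, s))).val : ℕ) : ZMod N) - l := by
    rw [ZMod.natCast_zmod_val]; ring
  rw [he]
  set r := (a - X.st (X.pos (v, s))).val
  by_cases hl : l ≤ r
  · rw [← Nat.cast_sub hl, val_natCast_of_lt (by omega)]
    omega
  · have : ((r : ZMod N) - l) = ((r + N - l : ℕ) : ZMod N) := by
      rw [Nat.cast_sub (by omega)]; simp
    rw [this, val_natCast_of_lt (by omega)]
    omega

theorem eq_add_val (a b : ZMod N) : b = a + ((b - a).val : ZMod N) := by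
  rw [ZMod.natCast_zmod_val]; ring

/-- Walking around the polygon, the border edge after one covered by a side is covered by that side
or by the next one. -/
theorem exists_mem_arc (c : C) (a : ZMod N) : ∃ x : C × ZMod (m + 2), x.1 = c ∧ a ∈ X.arc x := by
  have step : ∀ k : ℕ, ∃ x : C × ZMod (m + 2), x.1 = c ∧ X.st (c, 0) + (k : ZMod N) ∈ X.arc x := by
    intro k
    induction k with
    | zero => exact ⟨(c, 0), rfl, by simpa using X.st_mem_arc _⟩
    | succ k ih =>
      obtain ⟨x, hx, hk⟩ := ih
      rw [mem_arc] at hk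
      set b := X.st (c, 0) + (k : ZMod N)
      have hb : X.st (c, 0) + ((k + 1 : ℕ) : ZMod N) = b + 1 := by push_cast; ring
      rw [hb]
      have e : b + 1 = X.st x + (((b - X.st x).val + 1 : ℕ) : ZMod N) := by
        conv_lhs => rw [eq_add_val (X.st x) b]
        push_cast; ring
      rcases Nat.lt_or_ge ((b - X.st x).val + 1) (X.len x) with h | h
      · refine ⟨x, hx, ?_⟩
        have := X.len_lt x
        rw [mem_arc, e, add_sub_cancel_left, val_natCast_of_lt (by omega)]
        exact h
      · refine ⟨shift 1 x, hx, ?_⟩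
        have : (b - X.st x).val + 1 = X.len x := by omega
        rw [e, this, ← st_shift_one]
        exact X.st_mem_arc _
  have := step (a - X.st (c, 0)).val
  rwa [← eq_add_val] at this

theorem card_arc [DecidableEq (ZMod N)] (x : C × ZMod (m + 2)) :
    (Finset.univ.filter (fun a : ZMod N => (a - X.st x).val < X.len x)).card = X.len x := by
  have : Finset.univ.filter (fun a : ZMod N => (a - X.st x).val < X.len x) =
      (Finset.range (X.len x)).image (fun k : ℕ => X.st x + (k : ZMod N)) := by
    ext a
    simp only [Finset.mem_filter, Finset.mem_univ, true_and, Finset.mem_image, Finset.mem_range]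
    constructor
    · exact fun h => ⟨_, h, (eq_add_val _ _).symm⟩
    · rintro ⟨k, hk, rfl⟩
      have := X.len_lt x
      rwa [add_sub_cancel_left, val_natCast_of_lt (by omega)]
  rw [this, Finset.card_image_of_injOn, Finset.card_range]
  intro k hk l hl h
  have h' : ((k : ℕ) : ZMod N) = l := add_left_cancel h
  have := X.len_lt x
  simp only [Finset.coe_range, Set.mem_Iio] at hk hl
  have := congrArg ZMod.val h'
  rwa [val_natCast_of_lt (by omega), val_natCast_of_lt (by omega)] at this

theorem len_le_of_arc_subset {x y : C × ZMod (m + 2)} (h : X.arc x ⊆ X.arc y) :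
    X.len x ≤ X.len y := by
  classical
  rw [← X.card_arc x, ← X.card_arc y]
  exact Finset.card_le_card (fun a ha => by
    simp only [Finset.mem_filter, Finset.mem_univ, true_and] at ha ⊢
    exact h ha)

/-- Double counting: the arcs of a cell have total size `N` and cover all `N` edges, so they are
disjoint. -/
theorem eq_of_mem_arc {x y : C × ZMod (m + 2)} (h : x.1 = y.1) {a : ZMod N} (hx : a ∈ X.arc x)
    (hy : a ∈ X.arc y) : x = y := by
  classical
  obtain ⟨c, p⟩ := x
  obtain ⟨c', q⟩ := y
  obtain rfl : c = c' := h
  have hsum : ∑ b : ZMod N, 1 = ∑ b : ZMod N,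
      (Finset.univ.filter (fun p => (b - X.st (c, p)).val < X.len (c, p))).card := by
    have := Finset.sum_card_bipartiteAbove_eq_sum_card_bipartiteBelow (s := Finset.univ)
      (t := Finset.univ) (fun (b : ZMod N) p => (b - X.st (c, p)).val < X.len (c, p))
    simp only [Finset.bipartiteAbove, Finset.bipartiteBelow] at this
    rw [this, Finset.sum_congr rfl (fun p _ => X.card_arc (c, p)), X.sum_len]
    simp [ZMod.card]
  have hle : ∀ b ∈ (Finset.univ : Finset (ZMod N)), 1 ≤
      (Finset.univ.filter (fun p => (b - X.st (c, p)).val < X.len (c, p))).card := by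
    intro b _
    obtain ⟨⟨c', r⟩, rfl, hr⟩ := X.exists_mem_arc c b
    exact Finset.card_pos.2 ⟨r, by simpa using X.mem_arc.1 hr⟩
  have h1 := (Finset.sum_eq_sum_iff_of_le hle).1 hsum a (Finset.mem_univ _)
  have := Finset.card_le_one.1 h1.symm.le p (by simpa using X.mem_arc.1 hx)
    q (by simpa using X.mem_arc.1 hy)
  rw [this]

theorem arc_subset_arc_op {v : V} {s : Bool} {y : C × ZMod (m + 2)}
    (h : y.1 = (X.pos (v, !s)).1) (hne : y ≠ X.pos (v, !s)) :
    X.arc y ⊆ X.arc (X.pos (v, s)) := by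
  intro a ha
  by_contra hn
  have : a ∈ X.arc (X.pos (v, !s)) := by rw [X.arc_op]; exact hn
  exact hne (X.eq_of_mem_arc h ha this)

/-- A set of cells which is closed under passing to neighbouring cells. -/
def CellClosed (S : Set C) : Prop := ∀ v s, (X.pos (v, s)).1 ∈ S → (X.pos (v, !s)).1 ∈ S

-- Chase the edge `a`: while the side covering it is a diagonal, cross it; the covering side on the
-- far side is strictly shorter.
variable {X} in
theorem CellClosed.exists_border {S : Set C} (hS : X.CellClosed S) {c : C} (hc : c ∈ S)
    (a : ZMod N) : ∃ x : C × ZMod (m + 2), x ∉ Set.range X.pos ∧ X.st x = a ∧ x.1 ∈ S := by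
  have key : ∀ l : ℕ, ∀ y : C × ZMod (m + 2), X.len y = l → y.1 ∈ S → a ∈ X.arc y →
      ∃ x : C × ZMod (m + 2), x ∉ Set.range X.pos ∧ X.st x = a ∧ x.1 ∈ S := by
    intro l
    induction l using Nat.strong_induction_on with
    | _ l ih =>
      intro y hl hy ha
      by_cases hr : y ∈ Set.range X.pos
      · obtain ⟨⟨v, s⟩, rfl⟩ := hr
        obtain ⟨z, hz, haz⟩ := X.exists_mem_arc (X.pos (v, !s)).1 a
        have hne : z ≠ X.pos (v, !s) := by
          rintro rfl
          rw [X.arc_op] at haz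
          exact haz ha
        exact ih _ (hl ▸ X.len_lt_of_fst_eq_op hz hne) z rfl (hz ▸ hS _ _ hy) haz
      · refine ⟨y, hr, ?_, hy⟩
        rw [mem_arc, X.len_border y hr, Nat.lt_one_iff, ZMod.val_eq_zero, sub_eq_zero] at ha
        exact ha.symm
  obtain ⟨y, hy, ha⟩ := X.exists_mem_arc c a
  exact key _ y rfl (hy ▸ hc) ha

theorem exists_border (a : ZMod N) : ∃ x, x ∉ Set.range X.pos ∧ X.st x = a := by
  have hC : 0 < Fintype.card C := by
    rw [Nat.pos_iff_ne_zero]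
    intro h
    have := X.card_eq
    have := NeZero.ne N
    rw [h, zero_mul] at *
    omega
  obtain ⟨c⟩ := Fintype.card_pos_iff.1 hC
  obtain ⟨x, hx, ha, -⟩ := CellClosed.exists_border (X := X) (S := Set.univ)
    (fun _ _ _ => trivial) (c := c) trivial a
  exact ⟨x, hx, ha⟩

/-- By `card_eq` there are as many border sides as vertices, so the surjection of `exists_border` is
injective. -/
theorem border_unique {x y : C × ZMod (m + 2)} (hx : x ∉ Set.range X.pos)
    (hy : y ∉ Set.range X.pos) (h : X.st x = X.st y) : x = y := by
  classical
  let f : {x // x ∉ Set.range X.pos} → ZMod N := fun x => X.st x.1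
  have hf : Function.Surjective f := fun a => by
    obtain ⟨x, hx, ha⟩ := X.exists_border a
    exact ⟨⟨x, hx⟩, ha⟩
  have hcard : Fintype.card {x // x ∉ Set.range X.pos} = Fintype.card (ZMod N) := by
    rw [Fintype.card_subtype_compl, ZMod.card, Fintype.card_prod, ZMod.card]
    have : Fintype.card {x // x ∈ Set.range X.pos} = Fintype.card (V × Bool) :=
      (Fintype.card_congr (Equiv.ofInjective X.pos X.pos_inj)).symm
    rw [this, Fintype.card_prod, Fintype.card_bool]
    have := X.card_eq
    omega
  have := ((Fintype.bijective_iff_surjective_and_card f).2 ⟨hf, hcard⟩).1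
    (a₁ := ⟨x, hx⟩) (a₂ := ⟨y, hy⟩) h
  exact congrArg Subtype.val this

-- Connectedness of the dual graph: a closed set and its complement, also closed, would each own a
-- border side starting at `0`.
variable {X} in
theorem CellClosed.mem {S : Set C} (hS : X.CellClosed S) {c : C} (hc : c ∈ S) (c' : C) :
    c' ∈ S := by
  by_contra hn
  have hS' : X.CellClosed Sᶜ := fun v s h h' => h (by simpa using hS v (!s) h')
  obtain ⟨x, hx, hx0, hxS⟩ := hS.exists_border hc 0
  obtain ⟨y, hy, hy0, hyS⟩ := hS'.exists_border (c := c') hn 0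
  obtain rfl := X.border_unique hx hy (hx0.trans hy0.symm)
  exact hyS hxS

/-- The sides met when walking away from the cell `c`. -/
inductive Below (c : C) : C × ZMod (m + 2) → Prop
  | base (x : C × ZMod (m + 2)) (h : x.1 = c) : Below c x
  | step (v : V) (s : Bool) (y : C × ZMod (m + 2)) (hb : Below c (X.pos (v, s)))
      (h : y.1 = (X.pos (v, !s)).1) (hne : y ≠ X.pos (v, !s)) : Below c y

theorem exists_below (c : C) (w : V) : ∃ t, X.Below c (X.pos (w, t)) := by
  -- Cells all of whose sides have been met, except possibly the side through which the cell was
  -- entered.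
  let S : Set C := {c' | ∀ y : C × ZMod (m + 2), y.1 = c' → X.Below c y ∨
    ∃ u s, y = X.pos (u, !s) ∧ X.Below c (X.pos (u, s))}
  have hstep : ∀ v s, X.Below c (X.pos (v, s)) → (X.pos (v, !s)).1 ∈ S := by
    intro v s h y hy
    by_cases hne : y = X.pos (v, !s)
    · exact Or.inr ⟨v, s, hne, h⟩
    · exact Or.inl (.step v s y h hy hne)
  have hc : c ∈ S := fun y hy => Or.inl (.base y hy)
  have hmem : ∀ y, X.Below c y → y.1 ∈ S := by
    intro y hy
    cases hy with
    | base _ h => exact h ▸ hc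
    | step v s _ hb h hne => exact h ▸ hstep v s hb
  have hS : X.CellClosed S := by
    intro v s h
    rcases h _ rfl with h | ⟨u, s', he, hb⟩
    · exact hstep v s h
    · have := X.pos_inj he
      simp only [Prod.mk.injEq] at this
      obtain ⟨rfl, rfl⟩ := this
      simpa using hmem _ hb
  rcases hS.mem hc (X.pos (w, false)).1 _ rfl with h | ⟨u, s, he, hb⟩
  · exact ⟨false, h⟩
  · have := X.pos_inj he
    simp only [Prod.mk.injEq] at this
    obtain ⟨rfl, -⟩ := this
    exact ⟨s, hb⟩

variable {X} in
theorem Below.exists_arc_subset {c : C} {y : C × ZMod (m + 2)} (h : X.Below c y) :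
    ∃ x : C × ZMod (m + 2), x.1 = c ∧ X.arc y ⊆ X.arc x ∧ (y = x ∨ X.len y < X.len x) := by
  induction h with
  | base x h => exact ⟨x, h, subset_rfl, Or.inl rfl⟩
  | step v s y hb h hne ih =>
    obtain ⟨x, hx, hsub, hlen⟩ := ih
    refine ⟨x, hx, (X.arc_subset_arc_op h hne).trans hsub, Or.inr ?_⟩
    have := X.len_lt_of_fst_eq_op h hne
    rcases hlen with h | h
    · rwa [← h]
    · omega

end CellDissection

/-! ### Rotating one diagonal, and why it is mutation. -/

namespace CellDissection

variable {V C : Type*} [Fintype V] [Fintype C] {m N : ℕ} (X : CellDissection V C m N)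

section Cancel

variable {V : Type*} {m : ℕ}

/-- Mutating the quiver of a dissection meets only two situations: at most one arrow, which
survives, or two of different colours, which annihilate (`cancel_pair`). -/
theorem cancel_single {Q : ColouredQuiver V m} {i k : V} {P : Fin (m + 1) → Prop} [DecidablePred P]
    (hP : ∀ c d, P c → P d → c = d) (hQ : ∀ c, Q i k c = if P c then 1 else 0) (c : Fin (m + 1)) :
    ColouredQuiver.cancel Q i k c = if P c then 1 else 0 := by
  rw [ColouredQuiver.cancel, hQ]
  by_cases hc : P c
  · have : ∑ t ∈ Finset.univ.erase c, Q i k t = 0 := by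
      refine Finset.sum_eq_zero fun t ht => ?_
      rw [hQ, if_neg fun h => Finset.ne_of_mem_erase ht (hP _ _ h hc)]
    rw [this, Nat.sub_zero]
  · simp [hc]

theorem cancel_pair {Q : ColouredQuiver V m} {i k : V} {a b : Fin (m + 1)} (hab : a ≠ b)
    (hQ : ∀ c, Q i k c = (if c = a then 1 else 0) + (if c = b then 1 else 0)) (c : Fin (m + 1)) :
    ColouredQuiver.cancel Q i k c = 0 := by
  have h1 : Q i k c + ∑ t ∈ Finset.univ.erase c, Q i k t = 2 := by
    rw [Finset.add_sum_erase _ _ (Finset.mem_univ c), Finset.sum_congr rfl fun t _ => hQ t,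
      Finset.sum_add_distrib]
    simp
  have h2 : Q i k c ≤ 1 := by
    rw [hQ]
    split_ifs with h h' <;> simp_all
  rw [ColouredQuiver.cancel]
  omega

end Cancel

section Flip

variable (j : V)

theorem pos_ne_next (s t : Bool) : X.pos (j, s) ≠ shift 1 (X.pos (j, t)) := by
  intro h
  by_cases hst : s = t
  · subst hst
    exact one_ne_zero_zmod (shift_eq_self.1 h.symm)
  · have : t = !s := by cases s <;> cases t <;> simp_all
    subst this
    exact X.cell_ne j s (fst_eq_of_eq_shift h)

theorem eq_of_next_eq_next {s t : Bool}
    (h : shift 1 (X.pos (j, s)) = shift 1 (X.pos (j, t))) : s = t :=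
  congrArg Prod.snd (X.pos_inj (shift_inj h))

theorem next_ne_next (s : Bool) : shift 1 (X.pos (j, s)) ≠ shift 1 (X.pos (j, !s)) := fun h => by
  simpa using X.eq_of_next_eq_next j h

theorem pos_ne_pos_not (s : Bool) : X.pos (j, s) ≠ X.pos (j, !s) := fun h => by
  simpa using X.pos_inj h

theorem side_cases (x : C × ZMod (m + 2)) : (∃ s, x = X.pos (j, s)) ∨
    (∃ s, x = shift 1 (X.pos (j, s))) ∨ ∀ s, x ≠ X.pos (j, s) ∧ x ≠ shift 1 (X.pos (j, s)) := by
  by_cases h1 : ∃ s, x = X.pos (j, s)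
  · exact Or.inl h1
  by_cases h2 : ∃ s, x = shift 1 (X.pos (j, s))
  · exact Or.inr (Or.inl h2)
  · push Not at h1 h2
    exact Or.inr (Or.inr fun s => ⟨h1 s, h2 s⟩)

open Classical in
/-- How the sides are carried along when the diagonal `j` is rotated by one step inside the union of
its two cells. -/
noncomputable def move (x : C × ZMod (m + 2)) : C × ZMod (m + 2) :=
  -- If `j` runs from `A` to `B` with next sides `B B'` and `A A'` in its two cells, the new
  -- diagonal is `A' B'`. It takes the slot after its old one, and the side displaced there goes to
  -- the slot vacated in the other cell.
  if x = X.pos (j, false) then shift 1 (X.pos (j, false))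
  else if x = X.pos (j, true) then shift 1 (X.pos (j, true))
  else if x = shift 1 (X.pos (j, false)) then X.pos (j, true)
  else if x = shift 1 (X.pos (j, true)) then X.pos (j, false)
  else x

theorem move_pos (s : Bool) : X.move j (X.pos (j, s)) = shift 1 (X.pos (j, s)) := by
  cases s
  · simp [move]
  · have := X.pos_ne_pos_not j true
    simp_all [move]

theorem move_next (s : Bool) : X.move j (shift 1 (X.pos (j, s))) = X.pos (j, !s) := by
  have h1 := (X.pos_ne_next j false s).symm
  have h2 := (X.pos_ne_next j true s).symm
  have h3 := X.next_ne_next j s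
  cases s
  · simp [move, h1, h2]
  · simp only [move, h1, h2, if_false, Bool.not_true] at h3 ⊢
    simp [h3]

theorem move_of_ne {x : C × ZMod (m + 2)}
    (h : ∀ s, x ≠ X.pos (j, s) ∧ x ≠ shift 1 (X.pos (j, s))) : X.move j x = x := by
  simp [move, h]

theorem move_injective : Function.Injective (X.move j) := by
  rw [Finite.injective_iff_surjective]
  intro y
  rcases X.side_cases j y with ⟨s, rfl⟩ | ⟨s, rfl⟩ | h
  · exact ⟨shift 1 (X.pos (j, !s)), by simp [move_next]⟩
  · exact ⟨_, X.move_pos j s⟩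
  · exact ⟨y, X.move_of_ne j h⟩

open Classical in
/-- The first vertices of the sides after the rotation of the diagonal `j`. -/
noncomputable def flipSt (x : C × ZMod (m + 2)) : ZMod N :=
  if x = shift 1 (X.pos (j, false)) then X.st (shift 2 (X.pos (j, true)))
  else if x = shift 1 (X.pos (j, true)) then X.st (shift 2 (X.pos (j, false)))
  else X.st x

open Classical in
/-- The lengths of the sides after the rotation of the diagonal `j`. -/
noncomputable def flipLen (x : C × ZMod (m + 2)) : ℕ :=
  if x = shift 1 (X.pos (j, false)) then X.len (X.pos (j, false)) +
    X.len (shift 1 (X.pos (j, false))) - X.len (shift 1 (X.pos (j, true)))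
  else if x = shift 1 (X.pos (j, true)) then X.len (X.pos (j, true)) +
    X.len (shift 1 (X.pos (j, true))) - X.len (shift 1 (X.pos (j, false)))
  else if x = X.pos (j, false) then X.len (shift 1 (X.pos (j, true)))
  else if x = X.pos (j, true) then X.len (shift 1 (X.pos (j, false)))
  else X.len x

theorem flipSt_next (s : Bool) :
    X.flipSt j (shift 1 (X.pos (j, s))) = X.st (shift 2 (X.pos (j, !s))) := by
  have := X.next_ne_next j s
  cases s <;> simp_all [flipSt]

theorem flipSt_of_ne {x : C × ZMod (m + 2)} (h : ∀ s, x ≠ shift 1 (X.pos (j, s))) :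
    X.flipSt j x = X.st x := by
  simp [flipSt, h]

theorem flipLen_next (s : Bool) : X.flipLen j (shift 1 (X.pos (j, s))) = X.len (X.pos (j, s)) +
    X.len (shift 1 (X.pos (j, s))) - X.len (shift 1 (X.pos (j, !s))) := by
  have := X.next_ne_next j s
  cases s <;> simp_all [flipLen]

theorem flipLen_pos (s : Bool) :
    X.flipLen j (X.pos (j, s)) = X.len (shift 1 (X.pos (j, !s))) := by
  have h1 := X.pos_ne_next j s
  have h2 := X.pos_ne_pos_not j s
  cases s <;> simp_all [flipLen]

theorem flipLen_of_ne {x : C × ZMod (m + 2)}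
    (h : ∀ s, x ≠ X.pos (j, s) ∧ x ≠ shift 1 (X.pos (j, s))) : X.flipLen j x = X.len x := by
  simp [flipLen, h]

/-- Ensures that the truncated subtraction in `flipLen` is a genuine one. -/
theorem len_next_lt (s : Bool) : X.len (shift 1 (X.pos (j, !s))) < X.len (X.pos (j, s)) :=
  X.len_lt_of_fst_eq_op rfl (X.pos_ne_next j (!s) (!s)).symm

theorem flipSt_move {x : C × ZMod (m + 2)} (h : ∀ s, x ≠ X.pos (j, s)) :
    X.flipSt j (X.move j x) = X.st x := by
  rcases X.side_cases j x with ⟨s, rfl⟩ | ⟨s, rfl⟩ | h'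
  · exact absurd rfl (h s)
  · rw [move_next, X.flipSt_of_ne j (X.pos_ne_next j _), st_shift_one, ← X.st_op]
  · rw [X.move_of_ne j h', X.flipSt_of_ne j fun s => (h' s).2]

theorem flipLen_move {x : C × ZMod (m + 2)} (h : ∀ s, x ≠ X.pos (j, s)) :
    X.flipLen j (X.move j x) = X.len x := by
  rcases X.side_cases j x with ⟨s, rfl⟩ | ⟨s, rfl⟩ | h'
  · exact absurd rfl (h s)
  · rw [move_next, flipLen_pos, Bool.not_not]
  · rw [X.move_of_ne j h', X.flipLen_of_ne j h']

theorem next_next_ne_next (s t : Bool) : shift 2 (X.pos (j, s)) ≠ shift 1 (X.pos (j, t)) := by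
  intro h
  have : shift 1 (X.pos (j, s)) = X.pos (j, t) := by
    apply shift_inj (k := 1)
    rw [shift_shift, ← h]
    norm_num
  exact X.pos_ne_next j t s this.symm

theorem st_shift_two (x : C × ZMod (m + 2)) :
    X.st (shift 2 x) = X.st x + X.len x + X.len (shift 1 x) := by
  have : shift 2 x = shift 1 (shift 1 x) := by rw [shift_shift]; norm_num
  rw [this, st_shift_one, st_shift_one]

theorem flipSt_shift_one (x : C × ZMod (m + 2)) :
    X.flipSt j (shift 1 x) = X.flipSt j x + X.flipLen j x := by
  rcases X.side_cases j x with ⟨s, rfl⟩ | ⟨s, rfl⟩ | h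
  · rw [flipSt_next, X.flipSt_of_ne j (X.pos_ne_next j s), flipLen_pos, st_shift_two, ← X.st_op,
      Bool.not_not]
  · have h1 := X.len_next_lt j s
    have e : shift 1 (shift 1 (X.pos (j, s))) = shift 2 (X.pos (j, s)) := by
      rw [shift_shift]; norm_num
    rw [e, X.flipSt_of_ne j (fun t => X.next_next_ne_next j s t), flipSt_next, flipLen_next,
      Nat.cast_sub (by omega), st_shift_two, st_shift_two, ← X.st_op j (!s), Bool.not_not]
    push_cast
    ring
  · have h1 : ∀ s, shift 1 x ≠ shift 1 (X.pos (j, s)) := fun s e => (h s).1 (shift_inj e)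
    rw [X.flipSt_of_ne j h1, X.flipSt_of_ne j fun s => (h s).2, X.flipLen_of_ne j h, st_shift_one]

/-- In a cell at `j` only the slot of `j` and the next one change length, and their total stays the
same. -/
theorem sum_flipLen (c : C) : ∑ p, X.flipLen j (c, p) = N := by
  refine Eq.trans ?_ (X.sum_len c)
  by_cases hc : ∃ s, (X.pos (j, s)).1 = c
  · obtain ⟨s, rfl⟩ := hc
    set c := (X.pos (j, s)).1 with hc
    set q := (X.pos (j, s)).2 with hq
    have e0 : (c, q) = X.pos (j, s) := rfl
    have e1 : (c, q + 1) = shift 1 (X.pos (j, s)) := rfl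
    have hne : q + 1 ≠ q := fun h => one_ne_zero_zmod (m := m) (by simpa using h)
    have hother : ∀ p, p ≠ q → p ≠ q + 1 → X.flipLen j (c, p) = X.len (c, p) := by
      intro p h0 h1
      apply X.flipLen_of_ne
      intro t
      by_cases ht : t = s
      · subst ht
        exact ⟨fun h => h0 (congrArg Prod.snd h), fun h => h1 (congrArg Prod.snd h)⟩
      · have : t = !s := by cases s <;> cases t <;> simp_all
        subst this
        exact ⟨fun h => X.cell_ne j s (Prod.ext_iff.1 h).1,
          fun h => X.cell_ne j s (Prod.ext_iff.1 h).1⟩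
    have hsplit : ∀ f : ZMod (m + 2) → ℕ, ∑ p, f p =
        f q + (f (q + 1) + ∑ p ∈ (Finset.univ.erase q).erase (q + 1), f p) := by
      intro f
      rw [Finset.add_sum_erase _ _ (by simp [hne]), Finset.add_sum_erase _ _ (by simp)]
    rw [hsplit, hsplit (fun p => X.len (c, p)), e0, e1, flipLen_pos, flipLen_next,
      Finset.sum_congr rfl (fun p hp => hother p (by simp at hp; exact hp.2)
        (by simp at hp; exact hp.1))]
    have := X.len_next_lt j s
    omega
  · push Not at hc
    refine Finset.sum_congr rfl fun p _ => X.flipLen_of_ne j fun s =>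
      ⟨fun h => hc s (congrArg Prod.fst h).symm, fun h => hc s (congrArg Prod.fst h).symm⟩

/-- The dissection obtained by rotating the diagonal `j` clockwise by one step in the union of its
two cells. -/
noncomputable def flip : CellDissection V C m N where
  st := X.flipSt j
  len := X.flipLen j
  pos := fun d => X.move j (X.pos d)
  m_pos := X.m_pos
  pos_inj := (X.move_injective j).comp X.pos_inj
  len_pos := fun x => by
    rcases X.side_cases j x with ⟨s, rfl⟩ | ⟨s, rfl⟩ | h
    · rw [flipLen_pos]; exact X.len_pos _
    · rw [flipLen_next]
      have := X.len_next_lt j s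
      omega
    · rw [X.flipLen_of_ne j h]; exact X.len_pos _
  len_mod := fun x => by
    rcases X.side_cases j x with ⟨s, rfl⟩ | ⟨s, rfl⟩ | h
    · rw [flipLen_pos]; exact X.len_mod _
    · rw [flipLen_next]
      have h1 := X.len_next_lt j s
      have h2 := (X.len_mod (X.pos (j, s))).add (X.len_mod (shift 1 (X.pos (j, s))))
      refine Nat.ModEq.add_right_cancel (X.len_mod (shift 1 (X.pos (j, !s)))) ?_
      rw [Nat.sub_add_cancel (by omega)]
      exact h2
    · rw [X.flipLen_of_ne j h]; exact X.len_mod _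
  sum_len := X.sum_flipLen j
  st_next := fun c p => X.flipSt_shift_one j (c, p)
  st_op := fun v s => by
    by_cases hv : v = j
    · subst hv
      have e : shift 1 (shift 1 (X.pos (v, s))) = shift 2 (X.pos (v, s)) := by
        rw [shift_shift]; norm_num
      rw [move_pos, move_pos, ← flipSt_shift_one, flipSt_next, e, Bool.not_not,
        X.flipSt_of_ne v (fun t => X.next_next_ne_next v s t)]
    · rw [X.flipSt_move j fun _ => X.pos_ne hv _ _, X.flipSt_move j fun _ => X.pos_ne hv _ _,
        X.flipLen_move j fun _ => X.pos_ne hv _ _, X.st_op]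
  len_op := fun v s => by
    by_cases hv : v = j
    · subst hv
      rw [move_pos, move_pos, flipLen_next, flipLen_next, Bool.not_not]
      have := X.len_next_lt v s
      have h2 := X.len_next_lt v (!s)
      have := X.len_op v s
      rw [Bool.not_not] at h2
      omega
    · rw [X.flipLen_move j fun _ => X.pos_ne hv _ _, X.flipLen_move j fun _ => X.pos_ne hv _ _,
        X.len_op]
  len_border := fun x hx => by
    obtain ⟨y, rfl⟩ := (Finite.injective_iff_surjective.1 (X.move_injective j)) x
    have hy : y ∉ Set.range X.pos := by
      rintro ⟨d, rfl⟩
      exact hx ⟨d, rfl⟩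
    rw [X.flipLen_move j fun s h => hy ⟨_, h.symm⟩, X.len_border y hy]
  card_eq := X.card_eq

theorem flip_pos (d : V × Bool) : (X.flip j).pos d = X.move j (X.pos d) := rfl

end Flip

section Quiver

/-- The number of steps around a cell which corresponds to the colour `c`. -/
def steps (c : Fin (m + 1)) : ZMod (m + 2) := ((c : ℕ) + 1 : ℕ)

theorem steps_val (c : Fin (m + 1)) : (steps c).val = c + 1 :=
  val_natCast_of_lt (by omega)

theorem steps_injective : Function.Injective (steps : Fin (m + 1) → ZMod (m + 2)) := by
  intro c d h
  have := congrArg ZMod.val h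
  rw [steps_val, steps_val] at this
  exact Fin.ext (by omega)

theorem steps_ne_zero (c : Fin (m + 1)) : steps c ≠ 0 := by
  intro h
  have := steps_val c
  rw [h, ZMod.val_zero] at this
  omega

theorem exists_steps {k : ZMod (m + 2)} (h : k ≠ 0) : ∃ c : Fin (m + 1), k = steps c := by
  have h1 : k.val < m + 2 := ZMod.val_lt k
  have h2 : k.val ≠ 0 := fun e => h ((ZMod.val_eq_zero k).1 e)
  refine ⟨⟨k.val - 1, by omega⟩, ZMod.val_injective _ ?_⟩
  rw [steps_val]
  simp only
  omega

theorem steps_zero : steps (0 : Fin (m + 1)) = 1 := by simp [steps]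

theorem steps_add_one (c : Fin (m + 1)) (h : c ≠ Fin.last m) : steps c + 1 = steps (c + 1) := by
  have : ((c + 1 : Fin (m + 1)) : ℕ) = c + 1 := Fin.val_add_one_of_lt (Fin.lt_last_iff_ne_last.2 h)
  rw [steps, steps, this]
  push_cast
  ring

theorem steps_last : steps (Fin.last m) + 1 = 0 := by
  have : ((m + 2 : ℕ) : ZMod (m + 2)) = 0 := ZMod.natCast_self _
  rw [← this, steps, Fin.val_last]
  push_cast
  ring

/-- Going on around the cell back to the start: `(m - c + 1) + (c + 1) = m + 2`. This is the
symmetry between the colours `c` and `m - c`. -/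
theorem steps_rev (c : Fin (m + 1)) : steps c.rev + steps c = 0 := by
  have : ((m + 2 : ℕ) : ZMod (m + 2)) = 0 := ZMod.natCast_self _
  rw [← this, steps, steps, ← Nat.cast_add, Fin.val_rev]
  congr 1
  omega

/-- The diagonals `v` and `w` are sides of a common cell, and going clockwise around this cell one
passes `c` sides on the way from `v` to `w`. -/
def Adj (v w : V) (c : Fin (m + 1)) : Prop :=
  ∃ s t, X.pos (w, t) = shift (steps c) (X.pos (v, s))

open Classical in
/-- The coloured quiver of a dissection. -/
noncomputable def quiver : ColouredQuiver V m := fun v w c => if X.Adj v w c then 1 else 0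

variable {X}

theorem Adj.ne {v w : V} {c : Fin (m + 1)} (h : X.Adj v w c) : v ≠ w := by
  rintro rfl
  obtain ⟨s, t, h⟩ := h
  by_cases hst : t = s
  · subst hst
    exact steps_ne_zero c (shift_eq_self.1 h.symm)
  · have : t = !s := by cases s <;> cases t <;> simp_all
    subst this
    exact X.cell_ne v s (congrArg Prod.fst h).symm

theorem Adj.unique {v w : V} {c d : Fin (m + 1)} (h : X.Adj v w c) (h' : X.Adj v w d) : c = d := by
  have hne := h.ne
  obtain ⟨s, t, h⟩ := h
  obtain ⟨s', t', h'⟩ := h'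
  obtain ⟨rfl, rfl⟩ := X.not_share_two hne (congrArg Prod.fst h).symm (congrArg Prod.fst h').symm
  exact steps_injective (shift_eq_shift.1 (h.symm.trans h'))

theorem Adj.rev {v w : V} {c : Fin (m + 1)} (h : X.Adj v w c) : X.Adj w v c.rev := by
  obtain ⟨s, t, h⟩ := h
  refine ⟨t, s, ?_⟩
  rw [h, shift_shift, add_comm (steps c), steps_rev, shift_zero]

theorem adj_rev_iff {v w : V} {c : Fin (m + 1)} : X.Adj w v c.rev ↔ X.Adj v w c :=
  ⟨fun h => by simpa using h.rev, Adj.rev⟩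

theorem quiver_rev (v w : V) (c : Fin (m + 1)) : X.quiver w v c.rev = X.quiver v w c := by
  classical
  exact if_congr adj_rev_iff rfl rfl

theorem exists_adj {v w : V} (hne : v ≠ w) {s t : Bool}
    (h : (X.pos (v, s)).1 = (X.pos (w, t)).1) :
    ∃ c, X.pos (w, t) = shift (steps c) (X.pos (v, s)) := by
  obtain ⟨k, hk⟩ := exists_shift h
  have : k ≠ 0 := by
    rintro rfl
    rw [shift_zero] at hk
    exact X.pos_ne hne _ _ hk.symm
  obtain ⟨c, rfl⟩ := exists_steps this
  exact ⟨c, hk⟩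

theorem adj_zero_iff {v w : V} :
    X.Adj v w 0 ↔ ∃ s t, X.pos (w, t) = shift 1 (X.pos (v, s)) := by
  rw [Adj, steps_zero]

variable (X)

theorem flip_pos_of_not_adj {i j : V} (hij : i ≠ j) (h : ¬ X.Adj j i 0) (a : Bool) :
    (X.flip j).pos (i, a) = X.pos (i, a) :=
  X.move_of_ne j fun s => ⟨X.pos_ne hij _ _, fun e => h (adj_zero_iff.2 ⟨s, a, e⟩)⟩

/-- `j` advances by one slot while `i` stays, unless `i` was directly after `j`. In that case
(colour `m`) `i` lands directly before `j` in the other cell, which is colour `0 = m + 1`. -/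
theorem flip_adj_of_adj {i j : V} {c : Fin (m + 1)} (h : X.Adj i j c) :
    (X.flip j).Adj i j (c + 1) := by
  have hij := h.ne
  obtain ⟨a, s, h⟩ := h
  by_cases hc : c = Fin.last m
  · subst hc
    have e : shift 1 (X.pos (j, s)) = X.pos (i, a) := by
      rw [h, shift_shift, steps_last, shift_zero]
    refine ⟨a, !s, ?_⟩
    rw [flip_pos, flip_pos, ← e, move_next, move_pos, Fin.last_add_one, steps_zero]
  · have hmove : X.move j (X.pos (i, a)) = X.pos (i, a) := by
      refine X.move_of_ne j fun t => ⟨X.pos_ne hij _ _, fun e => ?_⟩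
      have ht := (X.not_share_two hij (congrArg Prod.fst h).symm (fst_eq_of_eq_shift e)).2
      subst ht
      rw [h, shift_shift] at e
      have := shift_eq_self.1 e.symm
      rw [steps_add_one c hc] at this
      exact steps_ne_zero _ this
    refine ⟨a, s, ?_⟩
    rw [flip_pos, flip_pos, hmove, move_pos, h, shift_shift, steps_add_one c hc]

theorem flip_adj_self_iff {i j : V} {c : Fin (m + 1)} :
    (X.flip j).Adj i j c ↔ X.Adj i j (c - 1) := by
  constructor
  · intro h
    have hij := h.ne
    obtain ⟨d, hd⟩ : ∃ d, X.Adj i j d := by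
      obtain ⟨a, s, e⟩ := h
      rw [flip_pos, flip_pos, move_pos] at e
      rcases X.side_cases j (X.pos (i, a)) with ⟨t, ht⟩ | ⟨t, ht⟩ | ht
      · exact absurd ht (X.pos_ne hij _ _)
      · exact ⟨_, Adj.rev (adj_zero_iff.2 ⟨t, a, ht⟩)⟩
      · rw [X.move_of_ne j ht] at e
        obtain ⟨d, hd⟩ := exists_adj hij (congrArg Prod.fst e).symm
        exact ⟨d, a, s, hd⟩
    have := h.unique (X.flip_adj_of_adj hd)
    rw [this, add_sub_cancel_right]
    exact hd
  · intro h
    have := X.flip_adj_of_adj h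
    rwa [sub_add_cancel] at this

variable [DecidableEq V]

/-- Allows `i` and `k` to be exchanged, which halves the case distinction in `cancel_addPaths`. -/
theorem cancel_addPaths_rev (j : V) {i k : V} (hik : i ≠ k) (c : Fin (m + 1)) :
    ColouredQuiver.cancel (ColouredQuiver.addPaths X.quiver j) k i c.rev =
      ColouredQuiver.cancel (ColouredQuiver.addPaths X.quiver j) i k c := by
  have h : ∀ d : Fin (m + 1), ColouredQuiver.addPaths X.quiver j k i d.rev =
      ColouredQuiver.addPaths X.quiver j i k d := by
    intro d
    rw [ColouredQuiver.addPaths, ColouredQuiver.addPaths, if_neg hik, if_neg hik.symm, quiver_rev,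
      quiver_rev, quiver_rev, quiver_rev]
    ring
  rw [ColouredQuiver.cancel, ColouredQuiver.cancel, h]
  congr 1
  symm
  refine Finset.sum_bij (fun t _ => t.rev) (fun t ht => ?_) (fun a _ b _ h => Fin.rev_injective h)
    (fun b hb => ⟨b.rev, ?_, by simp⟩) (fun t _ => (h t).symm)
  · simpa using ht
  · simp only [Finset.mem_erase, Finset.mem_univ, and_true] at hb ⊢
    exact fun h => hb (by rw [← h, Fin.rev_rev])

open Classical in
theorem addPaths_quiver {j i k : V} (hik : i ≠ k) (c : Fin (m + 1)) :
    ColouredQuiver.addPaths X.quiver j i k c = (if X.Adj i k c then 1 else 0) +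
      ((if X.Adj i j c ∧ X.Adj j k 0 then 1 else 0) +
        (if X.Adj j k c ∧ X.Adj j i 0 then 1 else 0)) := by
  simp only [ColouredQuiver.addPaths, hik, if_false, quiver, adj_rev_iff]
  congr 1
  by_cases h1 : X.Adj j k 0 <;> by_cases h2 : X.Adj j i 0 <;> simp [h1, h2]

-- Here `k` changes cells and `i` stays. If `i` is in the cell which `k` leaves, the old arrow of
-- colour `c0 + 1` and the new one of colour `c0` cancel, and `j` now separates `i` from `k`. If `i`
-- is in the other cell, `k` takes the slot of `j` there and inherits the colour `c0`. If `i` is in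
-- neither cell, nothing changes.
open Classical in
theorem cancel_addPaths_of_adj {i j k : V} (hij : i ≠ j) (hik : i ≠ k)
    (hk : X.Adj j k 0) (hi : ¬ X.Adj j i 0) (c : Fin (m + 1)) :
    ColouredQuiver.cancel (ColouredQuiver.addPaths X.quiver j) i k c =
      if (X.flip j).Adj i k c then 1 else 0 := by
  have hjk := hk.ne
  obtain ⟨s, t, h⟩ := adj_zero_iff.1 hk
  have hkt : (X.flip j).pos (k, t) = X.pos (j, !s) := by rw [flip_pos, h, move_next]
  have hia := X.flip_pos_of_not_adj hij hi
  by_cases hshare : ∃ a b, (X.pos (i, a)).1 = (X.pos (j, b)).1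
  · obtain ⟨a, b, hab⟩ := hshare
    obtain ⟨c0, hc0⟩ := exists_adj hij hab
    have hadj : X.Adj i j c0 := ⟨a, b, hc0⟩
    by_cases hbs : b = s
    · subst hbs
      have hlast : c0 ≠ Fin.last m := by
        rintro rfl
        rw [hc0, shift_shift, steps_last, shift_zero] at h
        exact X.pos_ne hik _ _ h.symm
      have hadj' : X.Adj i k (c0 + 1) :=
        ⟨a, t, by rw [h, hc0, shift_shift, steps_add_one c0 hlast]⟩
      have hne : c0 + 1 ≠ c0 := fun e => by
        have := congrArg Fin.val e
        rw [Fin.val_add_one_of_lt (Fin.lt_last_iff_ne_last.2 hlast)] at this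
        omega
      rw [cancel_pair hne, if_neg]
      · rintro ⟨a', b', e⟩
        refine (X.flip j).not_triangle hij hjk hik (s := b) (a := a) (b := t) ?_ ?_ a' b'
          (congrArg Prod.fst e).symm
        · rw [hia, hab, flip_pos, move_pos]; rfl
        · rw [hkt, flip_pos, move_pos]; rfl
      · intro d
        rw [addPaths_quiver X hik]
        have e1 : X.Adj i k d ↔ d = c0 + 1 := ⟨fun h => h.unique hadj', fun h => h ▸ hadj'⟩
        have e2 : X.Adj i j d ↔ d = c0 := ⟨fun h => h.unique hadj, fun h => h ▸ hadj⟩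
        simp [e1, e2, hk, hi]
    · have : b = !s := by cases s <;> cases b <;> simp_all
      subst this
      have hadj' : (X.flip j).Adj i k c0 := ⟨a, t, by rw [hkt, hia, hc0]⟩
      have e1 : ∀ d, (X.flip j).Adj i k d ↔ d = c0 :=
        fun d => ⟨fun h => h.unique hadj', fun h => h ▸ hadj'⟩
      have e2 : ∀ d, X.Adj i j d ↔ d = c0 :=
        fun d => ⟨fun h => h.unique hadj, fun h => h ▸ hadj⟩
      have e3 : ∀ d, ¬ X.Adj i k d := by
        rintro d ⟨a', b', e⟩
        exact X.not_triangle hij hjk hik hab (by rw [Bool.not_not, h]; rfl) a' b'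
          (congrArg Prod.fst e).symm
      refine cancel_single (fun _ _ h h' => h.unique h') (fun d => ?_) c
      rw [addPaths_quiver X hik]
      simp [e1, e2, e3, hk, hi]
  · push Not at hshare
    have e2 : ∀ d, ¬ X.Adj i j d := by
      rintro d ⟨a, b, e⟩
      exact hshare a b (congrArg Prod.fst e).symm
    have hkb : ∀ b, b ≠ t → (X.flip j).pos (k, b) = X.pos (k, b) := by
      intro b hb
      refine X.move_of_ne j fun s' => ⟨X.pos_ne hjk.symm _ _, fun e => hb ?_⟩
      exact (X.not_share_two hjk.symm (fst_eq_of_eq_shift e) (fst_eq_of_eq_shift h)).1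
    have e1 : ∀ d, (X.flip j).Adj i k d ↔ X.Adj i k d := by
      refine fun d => exists_congr fun a => exists_congr fun b => ?_
      by_cases hb : b = t
      · subst hb
        rw [hkt, hia]
        exact ⟨fun e => absurd (congrArg Prod.fst e).symm (hshare _ _),
          fun e => absurd (congrArg Prod.fst (e.symm.trans h)) (hshare _ _)⟩
      · rw [hkb b hb, hia]
    refine cancel_single (fun _ _ h h' => h.unique h') (fun d => ?_) c
    rw [addPaths_quiver X hik]
    simp [e1, e2, hi]

open Classical in
theorem cancel_addPaths {i j k : V} (hij : i ≠ j) (hjk : j ≠ k) (hik : i ≠ k) (c : Fin (m + 1)) :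
    ColouredQuiver.cancel (ColouredQuiver.addPaths X.quiver j) i k c =
      if (X.flip j).Adj i k c then 1 else 0 := by
  by_cases hk : X.Adj j k 0
  · by_cases hi : X.Adj j i 0
    · obtain ⟨s, t, h⟩ := adj_zero_iff.1 hk
      obtain ⟨s', a, h'⟩ := adj_zero_iff.1 hi
      have hs : s' = !s := by
        by_contra hs
        have : s' = s := by cases s <;> cases s' <;> simp_all
        subst this
        exact X.pos_ne hik _ _ (h'.trans h.symm)
      subst hs
      -- Both `i` and `k` follow `j` directly, in different cells, and exchange cells. The two paths
      -- add arrows of colours `m` and `0`, which cancel because `m > 0`.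
      have hlast : (Fin.last m) ≠ 0 := by
        have := X.m_pos
        rw [Ne, Fin.ext_iff, Fin.val_last, Fin.val_zero]
        omega
      have hij' : X.Adj i j (Fin.last m) := by simpa using hi.rev
      rw [cancel_pair hlast, if_neg]
      · rintro ⟨a', b', e⟩
        refine (X.flip j).not_triangle hij hjk hik (s := s) (a := a) (b := t) ?_ ?_ a' b'
          (congrArg Prod.fst e).symm
        · rw [flip_pos, flip_pos, h', move_next, move_pos, Bool.not_not]; rfl
        · rw [flip_pos, flip_pos, h, move_next, move_pos]; rfl
      · intro d
        rw [addPaths_quiver X hik]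
        have e1 : ¬ X.Adj i k d := by
          rintro ⟨a', b', e⟩
          refine X.not_triangle hij hjk hik (s := !s) (a := a) (b := t) ?_ ?_ a' b'
            (congrArg Prod.fst e).symm
          · rw [h']; rfl
          · rw [h, Bool.not_not]; rfl
        have e2 : X.Adj i j d ↔ d = Fin.last m := ⟨fun h => h.unique hij', fun h => h ▸ hij'⟩
        have e3 : X.Adj j k d ↔ d = 0 := ⟨fun h => h.unique hk, fun h => h ▸ hk⟩
        simp [e1, e2, e3, hk, hi]
    · exact X.cancel_addPaths_of_adj hij hik hk hi c
  · by_cases hi : X.Adj j i 0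
    · have := X.cancel_addPaths_of_adj hjk.symm hik.symm hi hk c.rev
      simpa only [X.cancel_addPaths_rev j hik, adj_rev_iff] using this
    · have e1 : ∀ d, (X.flip j).Adj i k d ↔ X.Adj i k d := fun d =>
        exists_congr fun a => exists_congr fun b => by
          rw [X.flip_pos_of_not_adj hij hi, X.flip_pos_of_not_adj hjk.symm hk]
      refine cancel_single (fun _ _ h h' => h.unique h') (fun d => ?_) c
      rw [addPaths_quiver X hik]
      simp [e1, hi, hk]

theorem cancel_addPaths_left {j k : V} (hjk : j ≠ k) (c : Fin (m + 1)) :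
    ColouredQuiver.cancel (ColouredQuiver.addPaths X.quiver j) j k c = X.quiver j k c := by
  classical
  refine cancel_single (fun _ _ h h' => h.unique h') (fun d => ?_) c
  have h : ¬ X.Adj j j d ∧ ¬ X.Adj j j 0 := ⟨fun h => h.ne rfl, fun h => h.ne rfl⟩
  simp [addPaths_quiver X hjk, h]

theorem cancel_addPaths_right {i j : V} (hij : i ≠ j) (c : Fin (m + 1)) :
    ColouredQuiver.cancel (ColouredQuiver.addPaths X.quiver j) i j c = X.quiver i j c := by
  classical
  refine cancel_single (fun _ _ h h' => h.unique h') (fun d => ?_) c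
  have h : ¬ X.Adj j j d ∧ ¬ X.Adj j j 0 := ⟨fun h => h.ne rfl, fun h => h.ne rfl⟩
  simp [addPaths_quiver X hij, h]

theorem quiver_flip (j : V) : (X.flip j).quiver = ColouredQuiver.mutate X.quiver j := by
  classical
  funext i k c
  rw [ColouredQuiver.mutate, ColouredQuiver.shiftColours]
  by_cases hik : i = k
  · subst hik
    rw [if_pos rfl, quiver, if_neg fun h => h.ne rfl, ColouredQuiver.cancel,
      ColouredQuiver.addPaths, if_pos rfl, quiver, if_neg fun h => h.ne rfl, zero_add, Nat.zero_sub]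
  rw [if_neg hik]
  by_cases hkj : k = j
  · subst hkj
    rw [if_pos rfl, X.cancel_addPaths_right hik, quiver, quiver]
    simp only [flip_adj_self_iff]
  rw [if_neg hkj]
  by_cases hij : i = j
  · subst hij
    rw [if_pos rfl, X.cancel_addPaths_left hik, quiver, quiver]
    have : (X.flip i).Adj i k c ↔ X.Adj i k (c + 1) := by
      rw [← adj_rev_iff, flip_adj_self_iff, ← adj_rev_iff, Fin.rev_sub, Fin.rev_rev]
    simp only [this]
  · rw [if_neg hij, X.cancel_addPaths hij (fun h => hkj h.symm) hik, quiver]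

end Quiver

end CellDissection

/-! ### The diagonals of a dissection form an `(m+2)`-angulation. -/

namespace Polygon

variable {N : ℕ}

theorem Cross.ne {d e : Sym2 (ZMod N)} (h : Cross d e) {a : ZMod N} (hd : a ∈ d) : a ∉ e := by
  obtain ⟨p, q, x, y, rfl, rfl, ⟨h1, h2⟩, ⟨h3, h4⟩⟩ := h
  rw [Sym2.mem_iff] at hd
  rw [Sym2.mem_iff]
  rcases hd with rfl | rfl <;> rintro (rfl | rfl) <;> simp at h1 h2 h3 h4

theorem val_sub_add_val_sub [NeZero N] {a b : ZMod N} (h : a ≠ b) : (a - b).val + (b - a).val = N := by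
  have : NeZero (a - b) := ⟨sub_ne_zero.2 h⟩
  have h1 := ZMod.val_neg_of_ne_zero (a - b)
  rw [neg_sub] at h1
  have := ZMod.val_lt (a - b)
  omega

end Polygon

namespace CellDissection

variable {V C : Type*} [Fintype V] [Fintype C] {m N : ℕ} (X : CellDissection V C m N)

/-- The diagonal of the polygon with the label `v`. -/
def diag (v : V) : Sym2 (ZMod N) := s(X.st (X.pos (v, false)), X.st (X.pos (v, true)))

theorem diag_eq (v : V) (s : Bool) : X.diag v = s(X.st (X.pos (v, s)), X.st (X.pos (v, !s))) := by
  cases s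
  · rfl
  · exact Sym2.eq_swap

theorem diag_flip {v j : V} (h : v ≠ j) : (X.flip j).diag v = X.diag v := by
  have := X.flipSt_move j (x := X.pos (v, false)) fun _ => X.pos_ne h _ _
  have := X.flipSt_move j (x := X.pos (v, true)) fun _ => X.pos_ne h _ _
  simp_all [diag, flip]

theorem exists_diag_eq {v : V} {a b : ZMod N} (h : X.diag v = s(a, b)) :
    ∃ s, X.st (X.pos (v, s)) = a ∧ X.st (X.pos (v, !s)) = b ∧
      X.len (X.pos (v, s)) = (b - a).val := by
  have key : ∀ s, X.st (X.pos (v, s)) = a → X.st (X.pos (v, !s)) = b →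
      X.len (X.pos (v, s)) = (b - a).val := by
    rintro s rfl rfl
    rw [X.st_op, add_sub_cancel_left, val_natCast_of_lt (X.len_lt _)]
  rw [diag, Sym2.eq_iff] at h
  rcases h with ⟨h1, h2⟩ | ⟨h1, h2⟩
  · exact ⟨false, h1, h2, key false h1 h2⟩
  · exact ⟨true, h2, h1, key true h2 h1⟩

theorem st_shift_natCast (x : C × ZMod (m + 2)) (k : ℕ) :
    X.st (shift (k : ZMod (m + 2)) x) =
      X.st x + ((∑ i ∈ Finset.range k, X.len (shift (i : ZMod (m + 2)) x) : ℕ) : ZMod N) := by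
  induction k with
  | zero => simp [shift_zero]
  | succ k ih =>
    rw [Finset.sum_range_succ, Nat.cast_add (R := ZMod N), ← add_assoc, ← ih, ← st_shift_one,
      shift_shift, Nat.cast_succ]

theorem sum_range_len (x : C × ZMod (m + 2)) :
    ∑ i ∈ Finset.range (m + 2), X.len (shift (i : ZMod (m + 2)) x) = N := by
  refine Eq.trans ?_ (X.sum_len x.1)
  refine Finset.sum_bij (fun i _ => x.2 + (i : ZMod (m + 2))) (fun _ _ => Finset.mem_univ _) ?_ ?_
    (fun _ _ => rfl)
  · intro i hi k hk h
    have := congrArg ZMod.val (add_left_cancel h)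
    rw [Finset.mem_range] at hi hk
    rwa [val_natCast_of_lt hi, val_natCast_of_lt hk] at this
  · intro p _
    exact ⟨(p - x.2).val, Finset.mem_range.2 (ZMod.val_lt _), (eq_add_val _ _).symm⟩

theorem sum_range_len_lt (x : C × ZMod (m + 2)) {k : ℕ} (hk : k < m + 2) :
    ∑ i ∈ Finset.range k, X.len (shift (i : ZMod (m + 2)) x) < N := by
  refine lt_of_lt_of_eq ?_ (X.sum_range_len x)
  refine Finset.sum_lt_sum_of_subset (i := k) (Finset.range_mono hk.le) (Finset.mem_range.2 hk)
    (by simp) (X.len_pos _) fun _ _ _ => Nat.zero_le _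

/-- Shows that a chord between vertices of one cell whose span is `1` modulo `m` must be a side of
it, as used in `exists_crossing`. -/
theorem sum_range_len_mod (x : C × ZMod (m + 2)) (k : ℕ) :
    ∑ i ∈ Finset.range k, X.len (shift (i : ZMod (m + 2)) x) ≡ k [MOD m] := by
  induction k with
  | zero => simp [Nat.ModEq]
  | succ k ih =>
    rw [Finset.sum_range_succ]
    exact ih.add (X.len_mod _)

theorem isMDiagonal_diag (v : V) : Polygon.IsMDiagonal m (X.diag v) := by
  refine ⟨_, _, rfl, ?_⟩
  obtain ⟨s, h1, h2, h3⟩ := X.exists_diag_eq (v := v) rfl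
  obtain ⟨t, h4, h5, h6⟩ := X.exists_diag_eq (v := v) Sym2.eq_swap
  rw [← h3, ← h6]
  exact ⟨X.two_le_len _, X.two_le_len _, (X.len_mod _).add_right 1, (X.len_mod _).add_right 1⟩

variable [NeZero N]

/-- Walk from one cell of `v` to `w`: the arc of `w` lies in the arc of some side of that cell,
which is a side of `v` or lies in the arc of the opposite side of `v`. -/
theorem exists_nested {v w : V} (h : v ≠ w) : ∃ s t, X.arc (X.pos (w, t)) ⊆ X.arc (X.pos (v, s)) ∧
    X.len (X.pos (w, t)) < X.len (X.pos (v, s)) := by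
  obtain ⟨t, ht⟩ := X.exists_below (X.pos (v, false)).1 w
  obtain ⟨x, hx, hsub, hlen⟩ := ht.exists_arc_subset
  by_cases hxv : x = X.pos (v, false)
  · subst hxv
    exact ⟨false, t, hsub, hlen.resolve_left (X.pos_ne h.symm _ _)⟩
  · have h1 := X.arc_subset_arc_op (v := v) (s := true) hx hxv
    have h2 := X.len_lt_of_fst_eq_op (v := v) (s := true) hx hxv
    refine ⟨true, t, hsub.trans h1, ?_⟩
    rcases hlen with rfl | h
    · exact h2
    · omega

theorem diag_injective : Function.Injective X.diag := by
  intro v w h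
  by_contra hne
  obtain ⟨s, t, hsub, hlen⟩ := X.exists_nested hne
  rw [X.diag_eq v s] at h
  obtain ⟨t', h1, h2, h3⟩ := X.exists_diag_eq h.symm
  have hl : X.len (X.pos (w, t')) = X.len (X.pos (v, s)) := by
    rw [h3, X.st_op, add_sub_cancel_left, val_natCast_of_lt (X.len_lt _)]
  by_cases htt : t' = t
  · subst htt; omega
  · have : t = !t' := by cases t <;> cases t' <;> simp_all
    subst this
    have hmem := hsub (X.st_mem_arc _)
    rw [h2, X.st_op] at hmem
    exact X.st_add_len_notMem_arc _ hmem

/-- For crossing diagonals with arcs `A` and `B`, the edges starting at `x`, `b`, `y`, `a` lie in `A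
∩ B`, in `B` only, in neither, and in `A` only. Each refutes one of the four nestings allowed by
`exists_nested`. -/
theorem not_cross (v w : V) : ¬ Polygon.Cross (X.diag v) (X.diag w) := by
  intro h
  by_cases hvw : v = w
  · subst hvw
    exact h.ne (Sym2.mem_mk_left _ _) (Sym2.mem_mk_left _ _)
  obtain ⟨a, b, x, y, hd, he, ⟨h1, h2⟩, ⟨h3, h4⟩⟩ := h
  obtain ⟨s, t, hsub, -⟩ := X.exists_nested hvw
  obtain ⟨s', hs1, hs2, hs3⟩ := X.exists_diag_eq hd
  obtain ⟨t', ht1, ht2, ht3⟩ := X.exists_diag_eq he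
  have hop := X.arc_op v s'
  have hop' := X.arc_op w t'
  set A := X.arc (X.pos (v, s'))
  set B := X.arc (X.pos (w, t'))
  have hab : ∀ z, z ∈ A ↔ (z - a).val < (b - a).val := fun z => by
    rw [mem_arc, hs1, hs3]
  have hba : ∀ z, z ∉ A ↔ (z - b).val < (a - b).val := fun z => by
    have h := X.mem_arc (x := X.pos (v, !s')) (a := z)
    rw [hop, hs2] at h
    obtain ⟨u, hu1, hu2, hu3⟩ := X.exists_diag_eq (hd.trans Sym2.eq_swap)
    have huu : u = !s' := by
      by_contra hne
      have : u = s' := by cases u <;> cases s' <;> simp_all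
      subst this
      have hbb : a = b := hs1.symm.trans hu1
      rw [hbb, sub_self, ZMod.val_zero] at h2
      omega
    rw [← huu, hu3] at h
    exact h
  have hxA : x ∈ A := (hab x).2 h2
  have hyA : y ∉ A := (hba y).2 h4
  have haA : a ∈ A := by
    rw [hab, sub_self, ZMod.val_zero]
    omega
  have hbA : b ∉ A := by
    rw [hba, sub_self, ZMod.val_zero]
    omega
  have hne : ∀ {p q : ZMod N}, 0 < (p - q).val → p ≠ q := by
    rintro p q h rfl
    simp at h
  have hxB : x ∈ B := by
    have := X.st_mem_arc (X.pos (w, t'))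
    rwa [ht1] at this
  have hyB : y ∉ B := by
    have := X.st_mem_arc (X.pos (w, !t'))
    rw [ht2, hop'] at this
    exact this
  have hB : ∀ z, z ∈ B ↔ (z - x).val < (y - x).val := fun z => by rw [mem_arc, ht1, ht3]
  -- going clockwise from `a` one meets `x`, `b`, `y`
  have hax := Polygon.val_sub_add_val_sub (hne h1)
  have hby := Polygon.val_sub_add_val_sub (hne h3)
  have e1 : (b - x).val = (b - a).val - (x - a).val := by
    rw [← ZMod.val_sub (by omega)]
    congr 1
    ring
  have e2 : (a - y).val = (a - b).val - (y - b).val := by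
    rw [← ZMod.val_sub (by omega)]
    congr 1
    ring
  have hbx : b ≠ x := by
    rintro rfl
    exact hbA hxA
  have hay : a ≠ y := by
    rintro rfl
    exact hyA haA
  have hxy : x ≠ y := by
    rintro rfl
    exact hyB hxB
  have hab' : a ≠ b := by
    rintro rfl
    exact hbA haA
  have s1 := Polygon.val_sub_add_val_sub hab'
  have s2 := Polygon.val_sub_add_val_sub hay
  have s3 := Polygon.val_sub_add_val_sub hbx
  have hyx : (y - x).val = (b - x).val + (y - b).val := by
    rw [← ZMod.val_add_of_lt (by omega)]
    congr 1
    ring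
  have hbB : b ∈ B := by
    rw [hB, hyx]
    omega
  have haB : a ∉ B := by
    rw [hB, hyx]
    omega
  have hs : s = s' ∨ s = !s' := by cases s <;> cases s' <;> simp
  have ht : t = t' ∨ t = !t' := by cases t <;> cases t' <;> simp
  rcases hs with rfl | rfl <;> rcases ht with rfl | rfl
  · exact hbA (hsub hbB)
  · rw [hop'] at hsub
    exact hyA (hsub hyB)
  · rw [hop] at hsub
    exact hsub hxB hxA
  · rw [hop, hop'] at hsub
    exact hsub haB haA

theorem st_injOn_cell {x y : C × ZMod (m + 2)} (h : x.1 = y.1) (hst : X.st x = X.st y) :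
    x = y :=
  X.eq_of_mem_arc h (X.st_mem_arc x) (hst ▸ X.st_mem_arc y)

/-- An `m`-diagonal which is not in the dissection leaves its first vertex `a` through a cell, and
crosses the opposite side of this cell. -/
theorem exists_crossing {a b : ZMod N} (hab : 2 ≤ (b - a).val) (hba : 2 ≤ (a - b).val)
    (hmod : (b - a).val ≡ 1 [MOD m]) (hd : ∀ v, X.diag v ≠ s(a, b)) :
    ∃ (j : V) (s : Bool) (r : ℕ), 1 ≤ r ∧ r ≤ m ∧
      X.st (shift ((r : ZMod (m + 2)) + 1) (X.pos (j, s))) = a ∧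
      Polygon.Cross (X.diag j) s(a, b) := by
  classical
  -- The longest side starting at `a` and shorter than the diagonal belongs to the cell which the
  -- diagonal enters at `a`; `y` will be the side through which it leaves.
  let F : Finset (C × ZMod (m + 2)) :=
    Finset.univ.filter fun x => X.st x = a ∧ X.len x < (b - a).val
  have hF : F.Nonempty := by
    obtain ⟨x, hx, ha⟩ := X.exists_border a
    refine ⟨x, Finset.mem_filter.2 ⟨Finset.mem_univ _, ha, ?_⟩⟩
    rw [X.len_border x hx]
    omega
  obtain ⟨x, hxF, hmax⟩ := F.exists_max_image X.len hF
  obtain ⟨hxa, hxlen⟩ : X.st x = a ∧ X.len x < (b - a).val := by simpa [F] using hxF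
  obtain ⟨y, hyx, hby⟩ := X.exists_mem_arc x.1 b
  have hbx : b ∉ X.arc x := by
    rw [mem_arc, hxa]
    omega
  have hne : y ≠ x := by
    rintro rfl
    exact hbx hby
  have hab' : a ≠ b := by
    rintro rfl
    simp at hab
  have hsum := Polygon.val_sub_add_val_sub hab'
  -- Suppose `y` ended at `a`. A diagonal `y` would have an opposite side starting at `a`, longer
  -- than `x` and at most as long as the given diagonal: against maximality, or equal to that
  -- diagonal. A border edge `y` would make `a` and `b` neighbours.
  have hny : shift 1 y ≠ x := by
    intro hn
    have hend : X.st y + X.len y = a := by rw [← st_shift_one, hn, hxa]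
    by_cases hr : y ∈ Set.range X.pos
    · obtain ⟨⟨v, s⟩, rfl⟩ := hr
      have hst : X.st (X.pos (v, !s)) = a := by rw [X.st_op, hend]
      have hb' : b ∉ X.arc (X.pos (v, !s)) := by
        rw [X.arc_op]
        exact fun h => h hby
      rw [mem_arc, hst, not_lt] at hb'
      have h1 := X.len_add_len_lt hyx hne
      have h2 := X.len_op v s
      rcases Nat.lt_or_ge (X.len (X.pos (v, !s))) (b - a).val with h | h
      · have := hmax (X.pos (v, !s)) (by simp [F, hst, h])
        omega
      · have hl : X.len (X.pos (v, !s)) = (b - a).val := by omega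
        refine hd v ?_
        have hv := X.st_op v (!s)
        rw [Bool.not_not, hst, hl, ← eq_add_val] at hv
        rw [X.diag_eq v s, hst, hv, Sym2.eq_swap]
    · have h1 := X.len_border y hr
      have h2 := X.mem_arc.1 hby
      rw [h1, Nat.lt_one_iff, ZMod.val_eq_zero, sub_eq_zero] at h2
      rw [h1, ← h2, Nat.cast_one] at hend
      rw [← hend, add_sub_cancel_left] at hba
      have : ((1 : ℕ) : ZMod N).val = 1 := val_natCast_of_lt (by omega)
      rw [Nat.cast_one] at this
      omega
  obtain ⟨k, hk⟩ := exists_shift hyx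
  obtain ⟨r, hrval, hr⟩ : ∃ r : ℕ, r < m + 2 ∧ k = (r : ZMod (m + 2)) :=
    ⟨k.val, ZMod.val_lt k, (ZMod.natCast_zmod_val k).symm⟩
  subst hr
  have hr0 : r ≠ 0 := by
    rintro rfl
    rw [Nat.cast_zero, shift_zero] at hk
    exact hne hk.symm
  have hr1 : r ≠ 1 := by
    rintro rfl
    rw [Nat.cast_one] at hk
    exact hny hk.symm
  have hbst : b ≠ X.st y := by
    intro hb
    -- the number of sides from `b` to `a` would be congruent to one modulo `m`
    have h1 := X.st_shift_natCast y r
    rw [← hk, hxa, ← hb] at h1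
    have h2 := X.sum_range_len_lt y hrval
    have h3 := X.sum_range_len_mod y r
    have h4 : (a - b).val = ∑ i ∈ Finset.range r, X.len (shift (i : ZMod (m + 2)) y) := by
      rw [h1, add_sub_cancel_left, val_natCast_of_lt h2]
    rw [← h4] at h3
    have h5 : N ≡ m + 2 [MOD m] := by
      have := X.sum_range_len_mod y (m + 2)
      rwa [X.sum_range_len] at this
    have h6 : r + 1 ≡ m + 2 [MOD m] := by
      rw [← hsum] at h5
      exact (h3.symm.add hmod.symm).trans h5
    have h7 : r ≡ 1 [MOD m] := by
      have : r + 1 ≡ 1 + 1 [MOD m] := h6.trans (by simp [Nat.ModEq])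
      exact Nat.ModEq.add_right_cancel' 1 this
    have h8 : m ∣ r - 1 := (Nat.modEq_iff_dvd' (by omega)).1 h7.symm
    have h9 : r = m + 1 := by
      have := Nat.le_of_dvd (by omega) h8
      omega
    have hy : y = shift 1 x := by
      rw [hk, shift_shift, h9]
      have : ((m + 2 : ℕ) : ZMod (m + 2)) = 0 := ZMod.natCast_self _
      have e : ((m + 1 : ℕ) : ZMod (m + 2)) + 1 = 0 := by
        rw [← this]
        push_cast
        ring
      rw [e, shift_zero]
    rw [hy, st_shift_one, hxa] at hb
    rw [hb, add_sub_cancel_left, val_natCast_of_lt (X.len_lt x)] at hxlen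
    omega
  have hr : y ∈ Set.range X.pos := by
    by_contra hr
    have h2 := X.mem_arc.1 hby
    rw [X.len_border y hr, Nat.lt_one_iff, ZMod.val_eq_zero, sub_eq_zero] at h2
    exact hbst h2
  obtain ⟨⟨j, s⟩, rfl⟩ := hr
  refine ⟨j, s, r - 1, by omega, by omega, ?_, ?_⟩
  · rw [← hxa, hk, ← Nat.cast_succ, Nat.succ_eq_add_one, Nat.sub_add_cancel (by omega)]
  · refine ⟨_, _, b, a, X.diag_eq j s, Sym2.eq_swap, ⟨?_, ?_⟩, ⟨?_, ?_⟩⟩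
    · rw [Nat.pos_iff_ne_zero, Ne, ZMod.val_eq_zero, sub_eq_zero]
      exact hbst
    · rw [X.st_op, add_sub_cancel_left, val_natCast_of_lt (X.len_lt _)]
      exact hby
    · rw [Nat.pos_iff_ne_zero, Ne, ZMod.val_eq_zero, sub_eq_zero, ← hxa, X.st_op, ← st_shift_one]
      exact fun h => hny (X.st_injOn_cell hyx h.symm)
    · have h1 : a ∉ X.arc (X.pos (j, s)) := fun h => by
        rw [← hxa] at h
        exact hne (X.eq_of_mem_arc hyx h (X.st_mem_arc x))
      have h2 : a ∈ X.arc (X.pos (j, !s)) := by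
        rw [X.arc_op]
        exact h1
      have h3 := X.st_op j (!s)
      rw [Bool.not_not] at h3
      rw [h3, add_sub_cancel_left, val_natCast_of_lt (X.len_lt _)]
      exact h2

theorem isAngulation_image_diag [DecidableEq (Sym2 (ZMod N))] :
    Polygon.IsAngulation m (Finset.univ.image X.diag) := by
  refine ⟨⟨?_, ?_⟩, ?_⟩
  · intro d hd
    obtain ⟨v, -, rfl⟩ := Finset.mem_image.1 hd
    exact X.isMDiagonal_diag v
  · intro d hd e he
    obtain ⟨v, -, rfl⟩ := Finset.mem_image.1 hd
    obtain ⟨w, -, rfl⟩ := Finset.mem_image.1 he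
    exact X.not_cross v w
  · rintro S ⟨hS, hcross⟩ hle d hd
    by_contra hn
    -- Maximality: an additional `m`-diagonal would cross a diagonal of the dissection.
    obtain ⟨a, b, rfl, hab, hba, hmod, -⟩ := hS d hd
    obtain ⟨j, -, -, -, -, -, hj⟩ := X.exists_crossing hab hba (Nat.ModEq.add_right_cancel' 1 hmod)
      fun v hv => hn (Finset.mem_image.2 ⟨v, Finset.mem_univ _, hv⟩)
    exact hcross _ (hle (Finset.mem_image_of_mem _ (Finset.mem_univ j))) _ hd hj

end CellDissection

/-! ### Rotations of diagonals reach every angulation. -/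

namespace CellDissection

variable {V C : Type*} [Fintype V] [Fintype C] {m N : ℕ}

/-- `Y` is obtained from `X` by finitely many rotations of diagonals. -/
def Reach (X Y : CellDissection V C m N) : Prop :=
  Relation.ReflTransGen (fun A B : CellDissection V C m N => ∃ j, B = A.flip j) X Y

/-- Any vertex of the two cells at the diagonal `j` can be made an end point of `j`. -/
theorem exists_reach_mem_diag {r : ℕ} (h1 : 1 ≤ r) (hr : r ≤ m) (X : CellDissection V C m N)
    (j : V) (s : Bool) : ∃ Y : CellDissection V C m N, X.Reach Y ∧
      (∀ v, v ≠ j → Y.diag v = X.diag v) ∧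
      X.st (shift ((r : ZMod (m + 2)) + 1) (X.pos (j, s))) ∈ Y.diag j := by
  induction r, h1 using Nat.le_induction generalizing X s with
  | base =>
    refine ⟨X.flip j, .single ⟨j, rfl⟩, fun v hv => X.diag_flip hv, ?_⟩
    have e : (X.flip j).st ((X.flip j).pos (j, !s)) = X.st (shift 2 (X.pos (j, s))) := by
      rw [flip_pos, move_pos]
      exact (X.flipSt_next j (!s)).trans (by rw [Bool.not_not])
    rw [(X.flip j).diag_eq j s, e, Nat.cast_one, one_add_one_eq_two]
    exact Sym2.mem_mk_right _ _
  | succ r h1 ih =>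
    -- After one rotation `j` sits one slot further on, so the same vertex is one step nearer.
    obtain ⟨Y, hY, hd, hmem⟩ := ih (by omega) (X.flip j) s
    refine ⟨Y, .head ⟨j, rfl⟩ hY, fun v hv => (hd v hv).trans (X.diag_flip hv), ?_⟩
    have hne : ∀ t, shift (((r + 1 : ℕ) : ZMod (m + 2)) + 1) (X.pos (j, s)) ≠
        shift 1 (X.pos (j, t)) := by
      intro t h
      by_cases hts : t = s
      · subst hts
        have := shift_eq_shift.1 h
        rw [add_eq_right] at this
        have h2 : ((r + 1 : ℕ) : ZMod (m + 2)).val = r + 1 := val_natCast_of_lt (by omega)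
        rw [this, ZMod.val_zero] at h2
        omega
      · have : t = !s := by cases s <;> cases t <;> simp_all
        subst this
        exact X.cell_ne j s (Prod.ext_iff.1 h).1
    have e : (X.flip j).st (shift ((r : ZMod (m + 2)) + 1) ((X.flip j).pos (j, s))) =
        X.st (shift (((r + 1 : ℕ) : ZMod (m + 2)) + 1) (X.pos (j, s))) := by
      rw [← X.flipSt_of_ne j hne, flip_pos, move_pos, shift_shift, add_comm (1 : ZMod (m + 2)),
        Nat.cast_succ]
      rfl
    rwa [e] at hmem

theorem Reach.mutationClass [DecidableEq V] {X Y : CellDissection V C m N} (h : X.Reach Y) :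
    Y.quiver ∈ ColouredQuiver.mutationClass X.quiver := by
  unfold Reach at h
  induction h with
  | refl => exact .refl
  | tail _ hj ih =>
    obtain ⟨j, rfl⟩ := hj
    exact Relation.ReflTransGen.tail ih ⟨j, quiver_flip _ j⟩

theorem exists_quiver_eq [DecidableEq V] {X : CellDissection V C m N} {Q : ColouredQuiver V m}
    (h : Q ∈ ColouredQuiver.mutationClass X.quiver) :
    ∃ Y : CellDissection V C m N, Y.quiver = Q := by
  unfold ColouredQuiver.mutationClass at h
  rw [Set.mem_ofPred_eq] at h
  induction h with
  | refl => exact ⟨X, rfl⟩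
  | tail _ hj ih =>
    obtain ⟨j, rfl⟩ := hj
    obtain ⟨Y, rfl⟩ := ih
    exact ⟨Y.flip j, quiver_flip _ j⟩

variable [NeZero N]

/-- Induction on the number of diagonals crossing `d`. The crossing diagonal from `exists_crossing`
is turned until it ends at an end point of `d`, where it no longer crosses `d`. Members of `Γ` do
not cross `d`, so they are never turned. -/
theorem exists_reach_diag_eq {Γ : Finset (Sym2 (ZMod N))} (hΓ : ∀ d ∈ Γ, Polygon.IsMDiagonal m d)
    (hcross : ∀ d ∈ Γ, ∀ e ∈ Γ, ¬ Polygon.Cross d e) {d : Sym2 (ZMod N)} (hd : d ∈ Γ)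
    (X : CellDissection V C m N) : ∃ Y : CellDissection V C m N, X.Reach Y ∧
      (∀ e ∈ Γ, e ∈ Set.range X.diag → e ∈ Set.range Y.diag) ∧ d ∈ Set.range Y.diag := by
  classical
  induction hk : (Finset.univ.filter fun v => Polygon.Cross (X.diag v) d).card using
    Nat.strong_induction_on generalizing X with
  | _ k ih =>
    by_cases hX : d ∈ Set.range X.diag
    · exact ⟨X, .refl, fun _ _ h => h, hX⟩
    obtain ⟨a, b, rfl, hab, hba, hmod, -⟩ := hΓ d hd
    obtain ⟨j, s, r, h1, hr, ha, hj⟩ := X.exists_crossing hab hba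
      (Nat.ModEq.add_right_cancel' 1 hmod) fun v hv => hX ⟨v, hv⟩
    obtain ⟨Y, hXY, hY, hmem⟩ := exists_reach_mem_diag h1 hr X j s
    rw [ha] at hmem
    have hlt : (Finset.univ.filter fun v => Polygon.Cross (Y.diag v) s(a, b)).card < k := by
      rw [← hk]
      refine Finset.card_lt_card (Finset.ssubset_iff_subset_ne.2 ⟨fun v hv => ?_, fun h => ?_⟩)
      · simp only [Finset.mem_filter, Finset.mem_univ, true_and] at hv ⊢
        rcases eq_or_ne v j with rfl | hvj
        · exact hj
        · rwa [hY v hvj] at hv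
      · have : j ∈ Finset.univ.filter fun v => Polygon.Cross (Y.diag v) s(a, b) := by
          rw [h]
          simpa using hj
        simp only [Finset.mem_filter, Finset.mem_univ, true_and] at this
        exact this.ne hmem (Sym2.mem_mk_left _ _)
    obtain ⟨Z, hYZ, hZ, hdZ⟩ := ih _ hlt Y rfl
    refine ⟨Z, hXY.trans hYZ, fun e he => ?_, hdZ⟩
    rintro ⟨v, rfl⟩
    refine hZ _ he ⟨v, hY v ?_⟩
    rintro rfl
    exact hcross _ he _ hd hj

theorem exists_reach_isAngulation [DecidableEq (Sym2 (ZMod N))] {Γ : Finset (Sym2 (ZMod N))}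
    (hΓ : Polygon.IsAngulation m Γ) (X : CellDissection V C m N) :
    ∃ Y : CellDissection V C m N, X.Reach Y ∧ Finset.univ.image Y.diag = Γ := by
  have key : ∀ S ⊆ Γ, ∃ Y : CellDissection V C m N, X.Reach Y ∧ ∀ e ∈ S, e ∈ Set.range Y.diag := by
    intro S
    induction S using Finset.induction_on with
    | empty => exact fun _ => ⟨X, .refl, by simp⟩
    | insert d S _ ih =>
      intro hS
      obtain ⟨hd, hS⟩ := Finset.insert_subset_iff.1 hS
      obtain ⟨Y, hXY, hY⟩ := ih hS
      obtain ⟨Z, hYZ, hZ, hdZ⟩ := exists_reach_diag_eq hΓ.1.1 hΓ.1.2 hd Y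
      refine ⟨Z, hXY.trans hYZ, fun e he => ?_⟩
      rcases Finset.mem_insert.1 he with rfl | he
      · exact hdZ
      · exact hZ e (hS he) (hY e he)
  obtain ⟨Y, hXY, hY⟩ := key Γ subset_rfl
  have hle : Γ ≤ Finset.univ.image Y.diag := fun e he => by simpa using hY e he
  exact ⟨Y, hXY, le_antisymm (hΓ.2 Y.isAngulation_image_diag.1 hle) hle⟩

end CellDissection

/-! ### The diagonals determine the quiver. -/

namespace CellDissection

variable {V C : Type*} [Fintype V] [Fintype C] {m N : ℕ} (X Y : CellDissection V C m N)

section DiagToQuiver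

/-- The sides `x` and `y` of cells of two dissections are the same segment of the polygon. -/
def SameSide (x y : C × ZMod (m + 2)) : Prop := X.st x = Y.st y ∧ X.len x = Y.len y

variable {X Y}

theorem SameSide.symm {x y : C × ZMod (m + 2)} (h : X.SameSide Y x y) : Y.SameSide X y x :=
  ⟨h.1.symm, h.2.symm⟩

theorem exists_sameSide_pos (h : X.diag = Y.diag) (v : V) (s : Bool) :
    ∃ t, X.SameSide Y (X.pos (v, s)) (Y.pos (v, t)) := by
  have h1 := X.diag_eq v s
  rw [h] at h1
  obtain ⟨t, h2, -, h3⟩ := Y.exists_diag_eq h1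
  refine ⟨t, h2.symm, ?_⟩
  rw [h3, X.st_op, add_sub_cancel_left, val_natCast_of_lt (X.len_lt _)]

variable [NeZero N]

/-- Recovers cells from segments: the successor of `x` in its cell is the longest segment starting
at the end of `x` and not reaching back around to the start of `x`. -/
theorem len_le_len_next {x y : C × ZMod (m + 2)} (hst : X.st y = X.st x + X.len x)
    (hlen : X.len y + X.len x < N) : X.len y ≤ X.len (shift 1 x) := by
  by_cases hy : y ∈ Set.range X.pos
  · obtain ⟨⟨w, t⟩, rfl⟩ := hy
    obtain ⟨t', ht'⟩ := X.exists_below x.1 w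
    obtain ⟨z, hz, hsub, -⟩ := ht'.exists_arc_subset
    by_cases htt : t' = t
    · subst htt
      have h1 := hsub (X.st_mem_arc _)
      rw [hst, ← st_shift_one] at h1
      rw [X.eq_of_mem_arc (x := shift 1 x) (y := z) hz.symm (X.st_mem_arc _) h1]
      exact X.len_le_of_arc_subset hsub
    · have : t' = !t := by cases t <;> cases t' <;> simp_all
      subst this
      have h1 := hsub (X.st_add_len_sub_one_mem_arc _)
      have h2 := X.st_op w (!t)
      rw [Bool.not_not] at h2
      rw [← h2, hst] at h1
      -- In this orientation the complement of the arc of `y` would fit inside the arc of `x`,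
      -- against `hlen`.
      have h3 := X.eq_of_mem_arc hz.symm (X.st_add_len_sub_one_mem_arc x) h1
      subst h3
      have := X.len_le_of_arc_subset hsub
      have := X.len_op w t
      omega
  · rw [X.len_border y hy]
    exact X.len_pos _

theorem exists_sameSide (h : X.diag = Y.diag) (x : C × ZMod (m + 2)) :
    ∃ y, X.SameSide Y x y := by
  by_cases hx : x ∈ Set.range X.pos
  · obtain ⟨⟨v, s⟩, rfl⟩ := hx
    obtain ⟨t, ht⟩ := exists_sameSide_pos h v s
    exact ⟨_, ht⟩
  · obtain ⟨y, hy, hst⟩ := Y.exists_border (X.st x)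
    exact ⟨y, hst.symm, by rw [X.len_border x hx, Y.len_border y hy]⟩

theorem SameSide.len_next_le (h : X.diag = Y.diag) {x y : C × ZMod (m + 2)}
    (hxy : X.SameSide Y x y) : X.len (shift 1 x) ≤ Y.len (shift 1 y) := by
  obtain ⟨z, hz1, hz2⟩ := exists_sameSide h (shift 1 x)
  rw [hz2]
  refine len_le_len_next ?_ ?_
  · rw [← hz1, st_shift_one, hxy.1, hxy.2]
  · rw [← hz2, ← hxy.2]
    exact X.len_add_len_lt rfl fun e => one_ne_zero_zmod (shift_eq_self.1 e)

theorem SameSide.next (h : X.diag = Y.diag) {x y : C × ZMod (m + 2)} (hxy : X.SameSide Y x y) :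
    X.SameSide Y (shift 1 x) (shift 1 y) :=
  ⟨by rw [st_shift_one, st_shift_one, hxy.1, hxy.2],
    le_antisymm (hxy.len_next_le h) (hxy.symm.len_next_le h.symm)⟩

theorem SameSide.shift_natCast (h : X.diag = Y.diag) {x y : C × ZMod (m + 2)}
    (hxy : X.SameSide Y x y) (k : ℕ) :
    X.SameSide Y (shift (k : ZMod (m + 2)) x) (shift (k : ZMod (m + 2)) y) := by
  induction k with
  | zero => simpa [shift_zero] using hxy
  | succ k ih =>
    have := ih.next h
    rwa [shift_shift, shift_shift, ← Nat.cast_succ] at this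

theorem SameSide.exists_pos_eq (h : X.diag = Y.diag) {v : V} {s : Bool} {y : C × ZMod (m + 2)}
    (hy : X.SameSide Y (X.pos (v, s)) y) : ∃ t, y = Y.pos (v, t) := by
  have hr : y ∈ Set.range Y.pos := by
    by_contra hr
    have h1 := Y.len_border y hr
    have h2 := X.two_le_len (v, s)
    have h3 := hy.2
    omega
  obtain ⟨⟨w, t⟩, rfl⟩ := hr
  have : Y.diag w = Y.diag v := by
    rw [← congrFun h v, Y.diag_eq w t, X.diag_eq v s, Y.st_op, X.st_op, hy.1, hy.2]
  rw [Y.diag_injective this]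
  exact ⟨t, rfl⟩

theorem Adj.of_diag_eq (h : X.diag = Y.diag) {v w : V} {c : Fin (m + 1)} (ha : X.Adj v w c) :
    Y.Adj v w c := by
  obtain ⟨s, t, ha⟩ := ha
  obtain ⟨s', hs'⟩ := exists_sameSide_pos h v s
  have := hs'.shift_natCast h ((c : ℕ) + 1)
  obtain ⟨t', ht'⟩ := SameSide.exists_pos_eq (v := w) (s := t) h (ha ▸ this)
  exact ⟨s', t', ht'.symm⟩

theorem quiver_eq_of_diag_eq (h : X.diag = Y.diag) : X.quiver = Y.quiver := by
  classical
  funext v w c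
  exact if_congr ⟨fun ha => ha.of_diag_eq h, fun ha => ha.of_diag_eq h.symm⟩ rfl rfl

end DiagToQuiver

/-! ### The quiver determines the diagonals up to rotation. -/

section QuiverToDiag

/-- The diagonal `w` is a side of the cell at the side `s` of `v`, and it comes `c + 1` steps after
`v`. -/
def SideAdj (v : V) (s : Bool) (w : V) (c : Fin (m + 1)) : Prop :=
  ∃ t, X.pos (w, t) = shift (steps c) (X.pos (v, s))

/-- The side `s` of `v` in `X` and the side `t` of `v` in `Y` have the same neighbours. -/
def SameNbrs (v : V) (s t : Bool) : Prop := ∀ w c, X.SideAdj v s w c ↔ Y.SideAdj v t w c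

variable {X Y}

theorem SideAdj.adj {v w : V} {s : Bool} {c : Fin (m + 1)} (h : X.SideAdj v s w c) :
    X.Adj v w c := by
  obtain ⟨t, h⟩ := h
  exact ⟨s, t, h⟩

theorem adj_iff_of_quiver_eq (h : X.quiver = Y.quiver) {v w : V} {c : Fin (m + 1)} :
    X.Adj v w c ↔ Y.Adj v w c := by
  have := congrFun (congrFun (congrFun h v) w) c
  unfold quiver at this
  by_cases h1 : X.Adj v w c <;> by_cases h2 : Y.Adj v w c <;> simp_all

/-- The quiver does not record in which cell two diagonals meet. Once the neighbours in one cell of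
`w` are known, those in its other cell are the remaining neighbours, so the comparison passes across
`w`. -/
theorem sideAdj_iff {v w u : V} {s t : Bool} {c d : Fin (m + 1)}
    (h : X.pos (w, t) = shift (steps c) (X.pos (v, s))) :
    X.SideAdj w (!t) u d ↔ X.Adj w u d ∧ u ≠ v ∧ ∀ e, ¬ X.SideAdj v s u e := by
  have hvw : v ≠ w := Adj.ne (X := X) ⟨s, t, h⟩
  have hcell := fst_eq_of_eq_shift h
  constructor
  · intro hu
    refine ⟨hu.adj, ?_, ?_⟩
    · rintro rfl
      obtain ⟨b, hb⟩ := hu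
      have := (X.not_share_two hvw hcell.symm (fst_eq_of_eq_shift hb)).2
      cases t <;> simp at this
    · rintro e ⟨b', hb'⟩
      have hwu := hu.adj.ne
      obtain ⟨b, hb⟩ := hu
      have := (X.not_share_two hwu (hcell.trans (fst_eq_of_eq_shift hb').symm)
        (fst_eq_of_eq_shift hb).symm).1
      cases t <;> simp at this
  · rintro ⟨⟨a, b, hb⟩, huv, hno⟩
    by_cases hat : a = t
    · subst hat
      obtain ⟨e, he⟩ := exists_adj (X := X) huv.symm (s := s) (t := b)
        (hcell.symm.trans (fst_eq_of_eq_shift hb).symm)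
      exact absurd ⟨b, he⟩ (hno e)
    · have : a = !t := by cases t <;> cases a <;> simp_all
      subst this
      exact ⟨b, hb⟩

theorem SameNbrs.inherit (hQ : X.quiver = Y.quiver) {v w : V} {s s' t t' : Bool}
    {c : Fin (m + 1)} (h : X.SameNbrs Y v s s') (hX : X.pos (w, t) = shift (steps c) (X.pos (v, s)))
    (hY : Y.pos (w, t') = shift (steps c) (Y.pos (v, s'))) : X.SameNbrs Y w (!t) (!t') := by
  intro u d
  rw [sideAdj_iff hX, sideAdj_iff hY, adj_iff_of_quiver_eq hQ]
  simp only [h u _]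

theorem sum_len_steps (v : V) (s : Bool) :
    ∑ c : Fin (m + 1), X.len (shift (steps c) (X.pos (v, s))) = X.len (X.pos (v, !s)) := by
  have h1 := X.sum_range_len (X.pos (v, s))
  rw [Finset.sum_range_succ', Nat.cast_zero, shift_zero] at h1
  have h2 := X.len_op v s
  have h3 := Fin.sum_univ_eq_sum_range
    (fun i => X.len (shift (((i + 1 : ℕ)) : ZMod (m + 2)) (X.pos (v, s)))) (m + 1)
  unfold steps
  omega

/-- Border sides have length `1`, and the length of a diagonal is the sum of the other sides of the
cell behind it; the induction is on the length of the region beyond `v`. -/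
theorem SameNbrs.len_steps_eq (hQ : X.quiver = Y.quiver) {v : V} {s s' : Bool}
    (h : X.SameNbrs Y v s s') (c : Fin (m + 1)) :
    X.len (shift (steps c) (X.pos (v, s))) = Y.len (shift (steps c) (Y.pos (v, s'))) := by
  induction hl : X.len (X.pos (v, !s)) using Nat.strong_induction_on generalizing v s s' c with
  | _ l ih =>
    by_cases hx : shift (steps c) (X.pos (v, s)) ∈ Set.range X.pos
    · obtain ⟨⟨w, t⟩, hw⟩ := hx
      obtain ⟨t', hw'⟩ := (h w c).1 ⟨t, hw⟩
      have hn := h.inherit hQ hw hw'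
      have hlt : X.len (X.pos (w, t)) < l := by
        rw [← hl]
        refine X.len_lt_of_fst_eq_op (s := !s) ?_ ?_
        · rw [Bool.not_not]
          exact fst_eq_of_eq_shift hw
        · rw [Bool.not_not]
          exact X.pos_ne (Adj.ne (X := X) ⟨s, t, hw⟩).symm _ _
      rw [← hw, ← hw']
      have e1 := X.sum_len_steps w (!t)
      have e2 := Y.sum_len_steps w (!t')
      rw [Bool.not_not] at e1 e2
      rw [← e1, ← e2]
      exact Finset.sum_congr rfl fun d _ => ih _ hlt hn d (by rw [Bool.not_not])
    · have hy : shift (steps c) (Y.pos (v, s')) ∉ Set.range Y.pos := by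
        rintro ⟨⟨w, t⟩, hw⟩
        obtain ⟨t', hw'⟩ := (h w c).2 ⟨t, hw⟩
        exact hx ⟨_, hw'⟩
      rw [X.len_border _ hx, Y.len_border _ hy]

theorem SameNbrs.len_op_eq (hQ : X.quiver = Y.quiver) {v : V} {s s' : Bool}
    (h : X.SameNbrs Y v s s') : X.len (X.pos (v, !s)) = Y.len (Y.pos (v, !s')) := by
  rw [← X.sum_len_steps, ← Y.sum_len_steps]
  exact Finset.sum_congr rfl fun d _ => h.len_steps_eq hQ d

theorem SameNbrs.st_steps_eq (hQ : X.quiver = Y.quiver) {v : V} {s s' : Bool}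
    (h : X.SameNbrs Y v s s') {T : ZMod N} (hT : Y.st (Y.pos (v, s')) = X.st (X.pos (v, s)) + T)
    (c : Fin (m + 1)) : Y.st (shift (steps c) (Y.pos (v, s'))) =
      X.st (shift (steps c) (X.pos (v, s))) + T := by
  unfold steps
  rw [st_shift_natCast, st_shift_natCast, hT]
  have : ∑ i ∈ Finset.range ((c : ℕ) + 1), Y.len (shift (i : ZMod (m + 2)) (Y.pos (v, s'))) =
      ∑ i ∈ Finset.range ((c : ℕ) + 1), X.len (shift (i : ZMod (m + 2)) (X.pos (v, s))) := by
    refine Finset.sum_congr rfl fun i hi => ?_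
    rcases i with _ | i
    · have h1 := h.len_op_eq hQ
      have h2 := X.len_op v s
      have h3 := Y.len_op v s'
      rw [Nat.cast_zero, shift_zero, shift_zero]
      omega
    · have := Finset.mem_range.1 hi
      exact (h.len_steps_eq hQ ⟨i, by omega⟩).symm
  rw [this]
  ring

/-- One neighbour `w` splits the neighbours of `v` between its two cells using the quiver alone:
those in the cell of `w` are joined to `w`, the others are not, by `not_triangle`. -/
theorem sideAdj_iff_of_sideAdj {v w u : V} {s : Bool} {c d : Fin (m + 1)}
    (h : X.SideAdj v s w c) : (X.SideAdj v s u d ↔ X.Adj v u d ∧ (u = w ∨ ∃ e, X.Adj w u e)) ∧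
      (X.SideAdj v (!s) u d ↔ X.Adj v u d ∧ ¬ (u = w ∨ ∃ e, X.Adj w u e)) := by
  have hvw := h.adj.ne
  obtain ⟨t, ht⟩ := h
  have h1 : X.SideAdj v s u d → (u = w ∨ ∃ e, X.Adj w u e) := by
    rintro ⟨b, hb⟩
    by_cases huw : u = w
    · exact Or.inl huw
    · obtain ⟨e, he⟩ := exists_adj (X := X) (Ne.symm huw)
        ((fst_eq_of_eq_shift ht).trans (fst_eq_of_eq_shift hb).symm)
      exact Or.inr ⟨e, t, b, he⟩
  have h2 : X.SideAdj v (!s) u d → ¬ (u = w ∨ ∃ e, X.Adj w u e) := by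
    intro hu
    have hvu := hu.adj.ne
    obtain ⟨b, hb⟩ := hu
    rintro (rfl | ⟨e, a', b', he⟩)
    · have := (X.not_share_two hvw (fst_eq_of_eq_shift ht).symm (fst_eq_of_eq_shift hb).symm).1
      cases s <;> simp at this
    · exact X.not_triangle hvw.symm hvu (Adj.ne (X := X) ⟨a', b', he⟩) (fst_eq_of_eq_shift ht)
        (fst_eq_of_eq_shift hb).symm a' b' (fst_eq_of_eq_shift he).symm
  have h3 : X.Adj v u d → X.SideAdj v s u d ∨ X.SideAdj v (!s) u d := by
    rintro ⟨a, b, hb⟩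
    by_cases ha : a = s
    · exact Or.inl ⟨b, ha ▸ hb⟩
    · have : a = !s := by cases s <;> cases a <;> simp_all
      exact Or.inr ⟨b, this ▸ hb⟩
  exact ⟨⟨fun h => ⟨h.adj, h1 h⟩, fun h => (h3 h.1).resolve_right fun h' => h2 h' h.2⟩,
    ⟨fun h => ⟨h.adj, h2 h⟩, fun h => (h3 h.1).resolve_left fun h' => h.2 (h1 h')⟩⟩

theorem exists_sameNbrs (hQ : X.quiver = Y.quiver) (v : V) :
    ∃ s, X.SameNbrs Y v false s ∧ X.SameNbrs Y v true (!s) := by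
  by_cases hv : ∃ w c, X.Adj v w c
  · obtain ⟨w, c, hX⟩ := hv
    have hY := (adj_iff_of_quiver_eq hQ).1 hX
    obtain ⟨s, hX⟩ := hX
    obtain ⟨s', hY⟩ := hY
    have h1 : X.SameNbrs Y v s s' := fun u d => by
      rw [(sideAdj_iff_of_sideAdj hX).1, (sideAdj_iff_of_sideAdj hY).1]
      simp only [adj_iff_of_quiver_eq hQ]
    have h2 : X.SameNbrs Y v (!s) (!s') := fun u d => by
      rw [(sideAdj_iff_of_sideAdj hX).2, (sideAdj_iff_of_sideAdj hY).2]
      simp only [adj_iff_of_quiver_eq hQ]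
    cases s
    · exact ⟨s', h1, h2⟩
    · exact ⟨!s', h2, by rwa [Bool.not_not]⟩
  · push Not at hv
    have h : ∀ s t, X.SameNbrs Y v s t := fun s t w c =>
      ⟨fun h => absurd h.adj (hv w c),
        fun h => absurd ((adj_iff_of_quiver_eq hQ).2 h.adj) (hv w c)⟩
    exact ⟨false, h _ _, h _ _⟩

/-- Carries the matching of cells and the common offset `T` along the walk away from `v`. -/
theorem Below.sameNbrs (hQ : X.quiver = Y.quiver) {v : V} {s₀ : Bool}
    (h0 : X.SameNbrs Y v false s₀) (h1 : X.SameNbrs Y v true (!s₀)) {T : ZMod N}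
    (hT : Y.st (Y.pos (v, s₀)) = X.st (X.pos (v, false)) + T) {y : C × ZMod (m + 2)}
    (hy : X.Below (X.pos (v, false)).1 y) : ∀ w t, y = X.pos (w, t) → ∃ t',
      X.SameNbrs Y w (!t) (!t') ∧ Y.st (Y.pos (w, t')) = X.st (X.pos (w, t)) + T := by
  have transfer : ∀ v s s' w t, X.SameNbrs Y v s s' →
      Y.st (Y.pos (v, s')) = X.st (X.pos (v, s)) + T → v ≠ w →
      (X.pos (v, s)).1 = (X.pos (w, t)).1 → ∃ t',
      X.SameNbrs Y w (!t) (!t') ∧ Y.st (Y.pos (w, t')) = X.st (X.pos (w, t)) + T := by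
    intro v s s' w t h hT hvw hcell
    obtain ⟨c, hc⟩ := exists_adj hvw hcell
    obtain ⟨t', ht'⟩ := (h w c).1 ⟨t, hc⟩
    exact ⟨t', h.inherit hQ hc ht', by rw [ht', hc, h.st_steps_eq hQ hT]⟩
  induction hy with
  | base x hx =>
    rintro w t rfl
    by_cases hvw : v = w
    · subst hvw
      cases t
      · exact ⟨s₀, h1, hT⟩
      · exact absurd hx.symm (X.cell_ne v false)
    · exact transfer v false s₀ w t h0 hT hvw hx.symm
  | step u a y hb h hne ih =>
    rintro w t rfl
    obtain ⟨a', hn, hst⟩ := ih u a rfl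
    have hlen := hn.len_op_eq hQ
    rw [Bool.not_not, Bool.not_not] at hlen
    have hst' : Y.st (Y.pos (u, !a')) = X.st (X.pos (u, !a)) + T := by
      rw [Y.st_op, X.st_op, hst, hlen]
      ring
    have huw : u ≠ w := by
      rintro rfl
      by_cases hta : t = a
      · subst hta
        exact X.cell_ne u t h
      · have : t = !a := by cases t <;> cases a <;> simp_all
        subst this
        exact hne rfl
    exact transfer u (!a) (!a') w t hn hst' huw h.symm

theorem exists_diag_eq_map [NeZero N] (hQ : X.quiver = Y.quiver) :
    ∃ T : ZMod N, ∀ w, Y.diag w = Sym2.map (fun i => i + T) (X.diag w) := by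
  by_cases hV : Nonempty V
  · obtain ⟨v⟩ := hV
    obtain ⟨s, h0, h1⟩ := exists_sameNbrs hQ v
    refine ⟨Y.st (Y.pos (v, s)) - X.st (X.pos (v, false)), fun w => ?_⟩
    obtain ⟨t, ht⟩ := X.exists_below (X.pos (v, false)).1 w
    obtain ⟨t', hn, hst⟩ := ht.sameNbrs hQ h0 h1
      (T := Y.st (Y.pos (v, s)) - X.st (X.pos (v, false))) (by ring) w t rfl
    have hlen := hn.len_op_eq hQ
    rw [Bool.not_not, Bool.not_not] at hlen
    rw [Y.diag_eq w t', X.diag_eq w t, Sym2.map_mk, Y.st_op, X.st_op, hst, hlen, add_right_comm]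
  · exact ⟨0, fun w => absurd ⟨w⟩ hV⟩

end QuiverToDiag

end CellDissection

/-! ### Chains of cells realise the oriented Dynkin diagrams. -/

namespace CellDissection

section Fan

/-- Auxiliary positions for `fan`: the first vertex of the cell `c` after its side `0`. -/
def fanStart (q : ℕ → ℕ) : ℕ → ℕ
  | 0 => 0
  | c + 1 => fanStart q c + (q c - 1)

/-- The first vertex of the `p`-th side of the cell `c` of `fan`. -/
def fanSt (k m : ℕ) (q : ℕ → ℕ) (c p : ℕ) : ℕ :=
  -- The sides `1, …, m + 1` start at `fanStart q c` and span `m + 1 + m * (k - c)` edges; the side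
  -- `0` begins where they end.
  if p = 0 then fanStart q c + 1 + m * (k + 1 - c)
  else fanStart q c + (p - 1) + if q c < p then m * (k - c) else 0

/-- The length of the `p`-th side of the cell `c` of `fan`. -/
def fanLen (k m : ℕ) (q : ℕ → ℕ) (c p : ℕ) : ℕ :=
  -- Every cell behind a side adds `m` edges: `c` cells lie behind the side `0`, and `k - c` behind
  -- the side `q c`. At the two ends of the chain this is zero and the side is a border edge.
  1 + (if p = 0 then m * c else 0) + if p = q c then m * (k - c) else 0

/-- The sides of the diagonals of `fan`. -/
def fanPos (k m : ℕ) (q : ℕ → ℕ) : Fin k × Bool → Fin (k + 1) × ZMod (m + 2)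
  | (v, false) => (v.castSucc, (q v : ZMod (m + 2)))
  | (v, true) => (v.succ, 0)

theorem mul_sub_add {k m c : ℕ} (h : c ≤ k) : m * (k + 1 - c) = m * (k - c) + m := by
  rw [Nat.succ_sub h, Nat.mul_succ]

theorem mul_sub_add_mul {k m c : ℕ} (h : c ≤ k) : m * (k - c) + m * c = m * k := by
  rw [← Nat.mul_add, Nat.sub_add_cancel h]

theorem val_add_one_eq {p : ZMod (m + 2)} :
    (p.val = m + 1 ∧ p + 1 = 0) ∨ (p.val < m + 1 ∧ (p + 1).val = p.val + 1) := by
  have h1 : p.val < m + 2 := ZMod.val_lt p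
  have h2 : p + 1 = ((p.val + 1 : ℕ) : ZMod (m + 2)) := by
    rw [Nat.cast_succ, ZMod.natCast_zmod_val]
  rcases Nat.lt_or_ge p.val (m + 1) with h | h
  · exact Or.inr ⟨h, by rw [h2, val_natCast_of_lt (by omega)]⟩
  · have : p.val = m + 1 := by omega
    exact Or.inl ⟨this, by rw [h2, this]; exact ZMod.natCast_self _⟩

/-- The dissection whose cells form a chain: the cells `c` and `c + 1` are separated by the
diagonal `c`, which is the side `q c` of the cell `c` and the side `0` of the cell `c + 1`. -/
def fan (k m : ℕ) (hm : 0 < m) (q : ℕ → ℕ) (hq : ∀ c, 0 < q c ∧ q c < m + 2) :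
    CellDissection (Fin k) (Fin (k + 1)) m ((k + 1) * m + 2) where
  st x := (fanSt k m q x.1 x.2.val : ℕ)
  len x := fanLen k m q x.1 x.2.val
  pos := fanPos k m q
  m_pos := hm
  pos_inj := by
    have hne : ∀ c, (q c : ZMod (m + 2)) ≠ 0 := fun c h => by
      have := val_natCast_of_lt (hq c).2
      rw [h, ZMod.val_zero] at this
      have := (hq c).1
      omega
    rintro ⟨v, _ | _⟩ ⟨w, _ | _⟩ h
    · have := (Prod.ext_iff.1 h).1
      simpa [fanPos] using this
    · exact absurd (Prod.ext_iff.1 h).2 (hne v)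
    · exact absurd (Prod.ext_iff.1 h).2.symm (hne w)
    · have := (Prod.ext_iff.1 h).1
      simpa [fanPos] using this
  len_pos x := by unfold fanLen; omega
  len_mod x := by
    unfold fanLen
    split_ifs <;> simp [Nat.ModEq, Nat.add_mod]
  sum_len c := by
    have h1 : ∀ p : ZMod (m + 2), p.val = 0 ↔ p = 0 := fun p => ZMod.val_eq_zero p
    have h2 : ∀ p : ZMod (m + 2), p.val = q c ↔ p = (q c : ZMod (m + 2)) := fun p =>
      ⟨fun h => by rw [← h, ZMod.natCast_zmod_val],
        fun h => by rw [h, val_natCast_of_lt (hq c).2]⟩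
    simp only [fanLen, h1, h2, Finset.sum_add_distrib, Finset.sum_ite_eq', Finset.mem_univ, if_true,
      Finset.sum_const, Finset.card_univ, ZMod.card, smul_eq_mul]
    have := mul_sub_add_mul (m := m) (Nat.lt_succ_iff.1 c.2)
    have : (k + 1) * m = m * k + m := by ring
    omega
  st_next c p := by
    have hc := Nat.lt_succ_iff.1 c.2
    have h1 := mul_sub_add (m := m) hc
    have h2 := mul_sub_add_mul (m := m) hc
    obtain ⟨h3, h4⟩ := hq c
    rw [← Nat.cast_add]
    rcases val_add_one_eq (p := p) with ⟨hp, hp'⟩ | ⟨hp, hp'⟩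
    · simp only [hp', ZMod.val_zero, fanSt, fanLen, hp, if_true]
      congr 1
      split_ifs <;> first | contradiction | omega
    · simp only [hp', fanSt, fanLen]
      by_cases h0 : p.val = 0
      · rw [h0]
        have : fanStart q c + 1 + m * (k + 1 - c) + (1 + m * c) =
            fanStart q c + ((k + 1) * m + 2) := by
          rw [Nat.succ_mul, Nat.mul_comm k m]
          omega
        have h5 : ¬ q c < 1 := by omega
        have h6 : ¬ 0 = q c := by omega
        simp only [zero_add, one_ne_zero, if_false, if_true, h5, h6, Nat.sub_self, add_zero]
        rw [this, Nat.cast_add, ZMod.natCast_self, add_zero]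
      · congr 1
        split_ifs <;> first | contradiction | omega
  st_op v s := by
    have hc : (v : ℕ) ≤ k := v.2.le
    have h1 := mul_sub_add (m := m) hc
    have h2 := mul_sub_add_mul (m := m) hc
    obtain ⟨h3, h4⟩ := hq v
    have h5 : ((q v : ℕ) : ZMod (m + 2)).val = q v := val_natCast_of_lt h4
    have h6 : ¬ q v = 0 := by omega
    have h7 : k + 1 - (v + 1) = k - v := by omega
    rw [← Nat.cast_add]
    cases s
    · simp only [fanPos, fanSt, fanLen, Bool.not_false, ZMod.val_zero, Fin.val_castSucc, h5, h6,
        Fin.val_succ, if_true, if_false, lt_irrefl, fanStart, h7]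
      congr 1
      omega
    · have e : fanStart q v + (q v - 1) + 1 + m * (k - v) + (1 + m * (v + 1)) =
          fanStart q v + (q v - 1) + ((k + 1) * m + 2) := by
        rw [Nat.succ_mul, Nat.mul_comm k m, Nat.mul_succ]
        omega
      have h8 : ¬ 0 = q (v + 1) := by
        have := (hq (v + 1)).1
        omega
      simp only [fanPos, fanSt, fanLen, Bool.not_true, ZMod.val_zero, Fin.val_castSucc, h5, h6, h8,
        Fin.val_succ, if_true, if_false, lt_irrefl, fanStart, h7, add_zero]
      rw [e, Nat.cast_add _ ((k + 1) * m + 2), ZMod.natCast_self, add_zero]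
  len_op v s := by
    have key : fanLen k m q v (q v) + fanLen k m q (v + 1) 0 = (k + 1) * m + 2 := by
      have h2 := mul_sub_add_mul (m := m) v.2.le
      have h3 := (hq v).1
      have h8 := (hq (v + 1)).1
      have h9 : ¬ q v = 0 := by omega
      have h10 : ¬ 0 = q (v + 1) := by omega
      simp only [fanLen, h9, h10, if_true, if_false]
      rw [Nat.succ_mul, Nat.mul_comm k m, Nat.mul_succ]
      omega
    have h5 : ((q v : ℕ) : ZMod (m + 2)).val = q v := val_natCast_of_lt (hq v).2
    cases s
    · simp only [fanPos, Bool.not_false, ZMod.val_zero, Fin.val_castSucc, Fin.val_succ, h5, key]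
    · simp only [fanPos, Bool.not_true, ZMod.val_zero, Fin.val_castSucc, Fin.val_succ, h5]
      rw [Nat.add_comm, key]
  len_border x hx := by
    obtain ⟨c, p⟩ := x
    have h1 : p.val = 0 → (c : ℕ) = 0 := by
      intro hp
      by_contra hc
      obtain ⟨v, rfl⟩ := Fin.exists_succ_eq.2 (fun h : c = 0 => hc (by simp [h]))
      exact hx ⟨(v, true), by rw [(ZMod.val_eq_zero p).1 hp]; rfl⟩
    have h2 : p.val = q c → (c : ℕ) = k := by
      intro hp
      by_contra hc
      obtain ⟨v, rfl⟩ := Fin.exists_castSucc_eq.2 (fun h : c = Fin.last k => hc (by simp [h]))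
      exact hx ⟨(v, false), by
        rw [Fin.val_castSucc] at hp
        simp only [fanPos]
        rw [← hp, ZMod.natCast_zmod_val]⟩
    unfold fanLen
    simp only
    split_ifs with h h' h'
    · simp [h1 h, (h2 h').symm]
    · simp [h1 h]
    · simp [h2 h']
    · rfl
  card_eq := by
    rw [Fintype.card_fin, Fintype.card_fin]
    ring

/-- Consecutive diagonals `i` and `i + 1` meet only in the cell `i + 1`, at the slots `0` and `q (i
+ 1)`. -/
theorem fan_adj_iff {k m : ℕ} (hm : 0 < m) {q : ℕ → ℕ} (hq : ∀ c, 0 < q c ∧ q c < m + 2)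
    {i j : Fin k} {c : Fin (m + 1)} : (fan k m hm q hq).Adj i j c ↔
      ((i : ℕ) + 1 = j ∧ q j = c + 1) ∨ ((j : ℕ) + 1 = i ∧ q i = c.rev + 1) := by
  have hcast : ∀ (v : Fin k) (d : Fin (m + 1)), ((q v : ℕ) : ZMod (m + 2)) = steps d ↔
      q v = d + 1 := by
    intro v d
    constructor
    · intro h
      have := congrArg ZMod.val h
      rwa [val_natCast_of_lt (hq v).2, steps_val] at this
    · intro h
      rw [h, steps]
  have key : ∀ (i j : Fin k) (c : Fin (m + 1)), (fan k m hm q hq).pos (j, false) =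
      shift (steps c) ((fan k m hm q hq).pos (i, true)) ↔ (i : ℕ) + 1 = j ∧ q j = c + 1 := by
    intro i j c
    rw [← hcast j c]
    simp only [fan, fanPos, shift, Prod.mk.injEq, zero_add, Fin.ext_iff, Fin.val_castSucc,
      Fin.val_succ]
    rw [eq_comm (a := (j : ℕ))]
  constructor
  · intro h
    have hne := h.ne
    obtain ⟨s, t, h⟩ := h
    cases s <;> cases t
    · have := fst_eq_of_eq_shift h
      simp only [fan, fanPos, Fin.castSucc_inj] at this
      exact absurd this.symm hne
    · right
      rw [← key, h, shift_shift, add_comm (steps c), steps_rev, shift_zero]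
    · exact Or.inl ((key i j c).1 h)
    · have := fst_eq_of_eq_shift h
      simp only [fan, fanPos, Fin.succ_inj] at this
      exact absurd this.symm hne
  · rintro (h | h)
    · exact ⟨true, false, (key i j c).2 h⟩
    · rw [← adj_rev_iff]
      exact ⟨true, false, (key j i c.rev).2 h⟩

theorem exists_quiver_eq_dynkinA (k : ℕ) {m : ℕ} (hm : 0 < m) (o : ℕ → Bool) :
    ∃ X : CellDissection (Fin k) (Fin (k + 1)) m ((k + 1) * m + 2),
      X.quiver = ColouredQuiver.dynkinA k m o := by
  classical
  -- Slot `1` gives colour `0` from `c - 1` to `c`, and slot `m + 1` gives colour `m`. The value at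
  -- `c = 0` plays no role, since no diagonal comes before the first.
  let q : ℕ → ℕ := fun c => if o (c - 1) then 1 else m + 1
  have hq : ∀ c, 0 < q c ∧ q c < m + 2 := fun c => by
    simp only [q]
    split_ifs <;> omega
  refine ⟨fan k m hm q hq, ?_⟩
  funext i j c
  have h1 : ∀ i j : Fin k, ∀ c : Fin (m + 1), ((i : ℕ) + 1 = j ∧ q j = c + 1) ↔
      ((i : ℕ) + 1 = j ∧ o i = true ∧ c = 0) ∨ ((i : ℕ) + 1 = j ∧ o i = false ∧ c = Fin.last m) := by
    intro i j c
    rw [Fin.ext_iff, Fin.ext_iff, Fin.val_zero, Fin.val_last]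
    by_cases hij : (i : ℕ) + 1 = j
    · have : q j = if o i then 1 else m + 1 := by
        simp only [q]
        rw [← hij, Nat.add_sub_cancel]
      rw [this]
      cases o i
      · simp [hij]
        omega
      · simp [hij]
    · simp [hij]
  have h2 : (fan k m hm q hq).Adj i j c ↔ (ColouredQuiver.DynkinArrow o i j ∧ c = 0) ∨
      (ColouredQuiver.DynkinArrow o j i ∧ c = Fin.last m) := by
    rw [fan_adj_iff, h1, h1, Fin.rev_eq_iff, Fin.rev_eq_iff, Fin.rev_zero, Fin.rev_last]
    unfold ColouredQuiver.DynkinArrow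
    tauto
  have h3 : c = 0 → c ≠ Fin.last m := by
    rintro rfl h
    have := congrArg Fin.val h
    rw [Fin.val_zero, Fin.val_last] at this
    omega
  unfold quiver ColouredQuiver.dynkinA
  simp only [h2]
  by_cases ha : ColouredQuiver.DynkinArrow o i j ∧ c = 0
  · have : ¬ (ColouredQuiver.DynkinArrow o j i ∧ c = Fin.last m) := fun h => h3 ha.2 h.2
    rw [if_pos ha, if_neg this, if_pos (Or.inl ha)]
  · simp [ha]

end Fan

section Transport

variable {V C : Type*} [Fintype V] [Fintype C] {m N : ℕ} (X : CellDissection V C m N)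

/-- Permuting the labels of the diagonals. -/
def relabel (σ : Equiv.Perm V) : CellDissection V C m N where
  st := X.st
  len := X.len
  pos d := X.pos (σ d.1, d.2)
  m_pos := X.m_pos
  pos_inj d e h := by
    have := X.pos_inj h
    simp only [Prod.mk.injEq, EmbeddingLike.apply_eq_iff_eq] at this
    exact Prod.ext this.1 this.2
  len_pos := X.len_pos
  len_mod := X.len_mod
  sum_len := X.sum_len
  st_next := X.st_next
  st_op v := X.st_op (σ v)
  len_op v := X.len_op (σ v)
  len_border x hx := X.len_border x fun ⟨d, hd⟩ => hx ⟨(σ.symm d.1, d.2), by simpa using hd⟩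
  card_eq := X.card_eq

/-- Rotating the polygon by `t` steps. -/
def translate (t : ZMod N) : CellDissection V C m N where
  st x := X.st x + t
  len := X.len
  pos := X.pos
  m_pos := X.m_pos
  pos_inj := X.pos_inj
  len_pos := X.len_pos
  len_mod := X.len_mod
  sum_len := X.sum_len
  st_next c p := by rw [X.st_next, add_right_comm]
  st_op v s := by rw [X.st_op, add_right_comm]
  len_op := X.len_op
  len_border := X.len_border
  card_eq := X.card_eq

theorem quiver_relabel (σ : Equiv.Perm V) (v w : V) (c : Fin (m + 1)) :
    (X.relabel σ).quiver v w c = X.quiver (σ v) (σ w) c := rfl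

theorem diag_relabel (σ : Equiv.Perm V) (v : V) : (X.relabel σ).diag v = X.diag (σ v) := rfl

theorem quiver_translate (t : ZMod N) : (X.translate t).quiver = X.quiver := rfl

theorem diag_translate (t : ZMod N) (v : V) :
    (X.translate t).diag v = Sym2.map (fun i => i + t) (X.diag v) := rfl

variable [NeZero N] [DecidableEq (ZMod N)] (Y : CellDissection V C m N)

/-- An isomorphism or a rotation is first absorbed by relabelling or translating a dissection; then
`exists_diag_eq_map` and `quiver_eq_of_diag_eq` apply. The permutation of labels comes from
`diag_injective`. -/
theorem iso_iff_rotate : (∃ σ : Equiv.Perm V, ∀ v w c, Y.quiver (σ v) (σ w) c = X.quiver v w c) ↔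
    ∃ t : ZMod N, Finset.univ.image Y.diag = (Finset.univ.image X.diag).image
      (Sym2.map fun i => i + t) := by
  classical
  constructor
  · rintro ⟨σ, h⟩
    have hQ : X.quiver = (Y.relabel σ).quiver := by
      funext v w c
      exact (h v w c).symm
    obtain ⟨t, ht⟩ := exists_diag_eq_map hQ
    refine ⟨t, ?_⟩
    ext d
    simp only [Finset.mem_image, Finset.mem_univ, true_and, exists_exists_eq_and]
    constructor
    · rintro ⟨v, rfl⟩
      exact ⟨σ.symm v, by rw [← ht, diag_relabel, Equiv.apply_symm_apply]⟩
    · rintro ⟨v, rfl⟩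
      exact ⟨σ v, ht v⟩
  · rintro ⟨t, ht⟩
    have hex : ∀ v, ∃ w, Y.diag w = (X.translate t).diag v := by
      intro v
      have : (X.translate t).diag v ∈ Finset.univ.image Y.diag := by
        rw [ht, diag_translate]
        exact Finset.mem_image_of_mem _ (Finset.mem_image_of_mem _ (Finset.mem_univ v))
      obtain ⟨w, -, hw⟩ := Finset.mem_image.1 this
      exact ⟨w, hw⟩
    choose f hf using hex
    have hinj : Function.Injective f := fun v w h =>
      (X.translate t).diag_injective (by rw [← hf, ← hf, h])
    let σ : Equiv.Perm V := Equiv.ofBijective f (Finite.injective_iff_bijective.1 hinj)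
    have hQ : (Y.relabel σ).quiver = (X.translate t).quiver :=
      quiver_eq_of_diag_eq (funext fun v => hf v)
    refine ⟨σ, fun v w c => ?_⟩
    rw [← quiver_relabel, hQ, quiver_translate]

end Transport

end CellDissection

/-! ### The bijection between the two sets of classes. -/

/-- Two quotients are in bijection if a relation between their representatives is total on both
sides and matches the equivalence relations. -/
theorem Quotient.nonempty_equiv_of_rel {α β : Type*} (s : Setoid α) (t : Setoid β)
    (R : α → β → Prop) (hl : ∀ a, ∃ b, R a b) (hr : ∀ b, ∃ a, R a b)
    (h : ∀ a a' b b', R a b → R a' b' → (s a a' ↔ t b b')) :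
    Nonempty (Quotient s ≃ Quotient t) := by
  choose f hf using hl
  choose g hg using hr
  exact ⟨⟨Quotient.map f fun a a' ha => (h _ _ _ _ (hf a) (hf a')).1 ha,
    Quotient.map g fun b b' hb => (h _ _ _ _ (hg b) (hg b')).2 hb,
    fun x => Quotient.inductionOn x fun a =>
      Quotient.sound ((h _ _ _ _ (hg (f a)) (hf a)).2 (t.refl _)),
    fun x => Quotient.inductionOn x fun b =>
      Quotient.sound ((h _ _ _ _ (hf (g b)) (hg b)).1 (s.refl _))⟩⟩

theorem ColouredQuiver.nonempty_equiv_angulation (k : ℕ) {m : ℕ} (hm : 0 < m) (o : ℕ → Bool) :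
    Nonempty (Quotient (isoSetoid (mutationClass (dynkinA k m o))) ≃
      Quotient (Polygon.rotationSetoid m ((k + 1) * m + 2))) := by
  obtain ⟨X₀, hX₀⟩ := CellDissection.exists_quiver_eq_dynkinA k hm o
  rw [← hX₀]
  -- A quiver and an angulation are related if one labelled dissection yields both.
  refine Quotient.nonempty_equiv_of_rel _ _ (fun Q Δ =>
    ∃ X : CellDissection (Fin k) (Fin (k + 1)) m ((k + 1) * m + 2),
      X.quiver = Q.1 ∧ Finset.univ.image X.diag = Δ.1) ?_ ?_ ?_
  · rintro ⟨Q, hQ⟩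
    obtain ⟨Y, rfl⟩ := CellDissection.exists_quiver_eq hQ
    exact ⟨⟨_, Y.isAngulation_image_diag⟩, Y, rfl, rfl⟩
  · rintro ⟨Δ, hΔ⟩
    obtain ⟨Y, hY, rfl⟩ := CellDissection.exists_reach_isAngulation hΔ X₀
    exact ⟨⟨_, hY.mutationClass⟩, Y, rfl, rfl⟩
  · rintro ⟨_, hQ⟩ ⟨_, hQ'⟩ ⟨_, hΔ⟩ ⟨_, hΔ'⟩ ⟨X, rfl, rfl⟩ ⟨Y, rfl, rfl⟩
    exact X.iso_iff_rotate Y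

theorem mainTheorem2 (n m : ℕ) (hn : 0 < n) (hm : 0 < m) (o : ℕ → Bool) :
    Finite (Quotient (ColouredQuiver.isoSetoid
      (ColouredQuiver.mutationClass (ColouredQuiver.dynkinA (n - 1) m o)))) ∧
    Nat.card (Quotient (ColouredQuiver.isoSetoid
      (ColouredQuiver.mutationClass (ColouredQuiver.dynkinA (n - 1) m o)))) =
    Nat.card (Quotient (Polygon.rotationSetoid m (n * m + 2))) := by
  obtain ⟨k, rfl⟩ : ∃ k, n = k + 1 := ⟨n - 1, by omega⟩
  obtain ⟨e⟩ := ColouredQuiver.nonempty_equiv_angulation k hm o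
  have : Finite (Polygon.Angulation m ((k + 1) * m + 2)) := Subtype.finite
  exact ⟨Finite.of_equiv _ e.symm, Nat.card_congr e⟩
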